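/- **Theorem (Quadratic strong law for $S_n-\mu W_n$).** Let $d\ge 1$ and $p\in[0,1]$, with $p<1$ if $d\ge 2$. Let $J_d$ be the $d\times d$ cyclic shift matrix, with entries $(J_d)_{i,i+1}=1$ for $1\le i<d$, $(J_d)_{d,1}=1$, and all other entries $0$. On a probability space consider the multidimensional elephant random walk with random step sizes, defined as follows. * $X_1$ is uniformly distributed on $\{\pm e_1,\dots,\pm e_d\}\subset\mathbb{R}^d$. For $n\ge 1$, $X_{n+1}=A_{n+1}X_{\beta(n)}$ almost surely, where $\beta(n)$ is uniformly distributed on $\{1,\dots,n\}$, and the random matrix $A_{n+1}$ equals $I_d$ with probability $p$ and each of the $2d-1$ matrices $-I_d,\pm J_d,\pm J_d^2,\dots,\pm J_d^{d-1}$ with probability $(1-p)/(2d-1)$. * $Y_1$ is an almost surely positive random variable with finite mean and variance. The variables $Y_2,Y_3,\dots$ are almost surely non-negative, independent and identically distributed, with finite mean $\mu$ and finite variance $\eta^2$. * For every $n\ge1$, the variables $A_{n+1}$, $\beta(n)$, $Y_{n+1}$ and the family $(X_1,\dots,X_n,Y_1,\dots,Y_n)$ are mutually independent. Put $W_n=\sum_{k=1}^n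 X_k$ and $S_n=\sum_{k=1}^n T_k$, where $T_1=X_1Y_1$ and $T_{n+1}=A_{n+1}X_{\beta(n)}Y_{n+1}$ for $n\ge1$. Assume that $\mathbb{E}(|Y_n-\mu|^3)<\infty$ for all $n\ge1$. Then $$\lim_{n\to\infty}\frac{1}{\log(n+1)}\sum_{k=1}^{n}\frac{(S_k-\mu W_k)(S_k-\mu W_k)^t}{k(k+1)}=\frac{\eta^2}{d}\,I_d\qquad\text{almost surely.}$$ -/

import Mathlib

open MeasureTheory ProbabilityTheory Filter
open scoped Topology Matrix

/-- The product (equivalently Borel) `σ`-algebra on real square matrices. -/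
instance matrixMeasurableSpace (d : ℕ) : MeasurableSpace (Matrix (Fin d) (Fin d) ℝ) :=
  inferInstanceAs (MeasurableSpace (Fin d → Fin d → ℝ))

/-- The cyclic shift matrix `J_d`: ones just above the diagonal and in the lower left corner. -/
def shiftMatrix (d : ℕ) : Matrix (Fin d) (Fin d) ℝ :=
  Matrix.of fun i j => if (j : ℕ) = ((i : ℕ) + 1) % d then 1 else 0

/-- The `σ`-algebra generated by `X₁, …, Xₙ, Y₁, …, Yₙ`. -/
abbrev pastSigma {Ω : Type*} {d : ℕ} (X : ℕ → Ω → Fin d → ℝ) (Y : ℕ → Ω → ℝ) (n : ℕ) :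
    MeasurableSpace Ω :=
  ⨆ k ∈ Finset.Icc 1 n,
    (MeasurableSpace.comap (X k) inferInstance ⊔ MeasurableSpace.comap (Y k) inferInstance)

/-- The multidimensional elephant random walk with memory parameter `p` and random step sizes.
`X n` is the direction of the `n`-th step and `Y n` its size (`n ≥ 1`), `A (n + 1)` and `β n` are
the random matrix and the random time used for the `(n + 1)`-st step (`n ≥ 1`); `μ` and `η ^ 2` are
the common mean and variance of `Y n`, `n ≥ 2`. Values at other indices play no role. -/
structure IsElephantWalk {Ω : Type*} [MeasurableSpace Ω] (P : Measure Ω) (d : ℕ) (p μ η : ℝ)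
    (A : ℕ → Ω → Matrix (Fin d) (Fin d) ℝ) (β : ℕ → Ω → ℕ)
    (X : ℕ → Ω → Fin d → ℝ) (Y : ℕ → Ω → ℝ) : Prop where
  measurable_A : ∀ n, 1 ≤ n → Measurable (A (n + 1))
  measurable_β : ∀ n, 1 ≤ n → Measurable (β n)
  measurable_X : ∀ n, 1 ≤ n → Measurable (X n)
  measurable_Y : ∀ n, 1 ≤ n → Measurable (Y n)
  /-- `X₁` is uniform on `{± e₁, …, ± e_d}`. -/
  first_pos : ∀ i : Fin d, P.real {ω | X 1 ω = Pi.single i 1} = 1 / (2 * (d : ℝ))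
  first_neg : ∀ i : Fin d, P.real {ω | X 1 ω = -Pi.single i 1} = 1 / (2 * (d : ℝ))
  /-- `β n` is uniform on `{1, …, n}`. -/
  law_β : ∀ n, 1 ≤ n → ∀ k ∈ Finset.Icc 1 n, P.real {ω | β n ω = k} = 1 / (n : ℝ)
  /-- `A (n + 1)` is the identity with probability `p`, and each of the other `2 d - 1` signed
  powers of the cyclic shift with probability `(1 - p) / (2 d - 1)`. -/
  law_A_one : ∀ n, 1 ≤ n → P.real {ω | A (n + 1) ω = 1} = p
  law_A_neg_one : ∀ n, 1 ≤ n →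
    P.real {ω | A (n + 1) ω = -1} = (1 - p) / (2 * (d : ℝ) - 1)
  law_A_pow : ∀ n, 1 ≤ n → ∀ i, 1 ≤ i → i < d →
    P.real {ω | A (n + 1) ω = shiftMatrix d ^ i} = (1 - p) / (2 * (d : ℝ) - 1)
  law_A_neg_pow : ∀ n, 1 ≤ n → ∀ i, 1 ≤ i → i < d →
    P.real {ω | A (n + 1) ω = -(shiftMatrix d ^ i)} = (1 - p) / (2 * (d : ℝ) - 1)
  /-- The next direction is a transformed copy of a direction chosen from the past. -/
  recursion : ∀ n, 1 ≤ n → ∀ᵐ ω ∂P, X (n + 1) ω = A (n + 1) ω *ᵥ X (β n ω) ω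
  /-- `A (n + 1)`, `β n`, `Y (n + 1)` and the past are mutually independent; in particular
  `Y 2, Y 3, …` are independent of one another. -/
  indep : ∀ n, 1 ≤ n → iIndep
    (![MeasurableSpace.comap (A (n + 1)) inferInstance, MeasurableSpace.comap (β n) inferInstance,
      MeasurableSpace.comap (Y (n + 1)) inferInstance, pastSigma X Y n] :
        Fin 4 → MeasurableSpace Ω) P
  first_size_pos : ∀ᵐ ω ∂P, 0 < Y 1 ω
  first_size_memLp : MemLp (Y 1) 2 P
  size_nonneg : ∀ n, 2 ≤ n → ∀ᵐ ω ∂P, 0 ≤ Y n ω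
  size_identDistrib : ∀ n, 2 ≤ n → IdentDistrib (Y n) (Y 2) P P
  size_memLp : MemLp (Y 2) 2 P
  size_mean : ∫ ω, Y 2 ω ∂P = μ
  size_variance : variance (Y 2) P = η ^ 2

/-- The steps `T₁ = X₁ Y₁` and `T_{n+1} = A_{n+1} X_{β(n)} Y_{n+1}` of the walk with random
step sizes. -/
def walkStep {Ω : Type*} {d : ℕ} (A : ℕ → Ω → Matrix (Fin d) (Fin d) ℝ) (β : ℕ → Ω → ℕ)
    (X : ℕ → Ω → Fin d → ℝ) (Y : ℕ → Ω → ℝ) : ℕ → Ω → Fin d → ℝ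
  | 0, _ => 0
  | 1, ω => Y 1 ω • X 1 ω
  | n + 2, ω => Y (n + 2) ω • (A (n + 2) ω *ᵥ X (β (n + 1) ω) ω)

/-- The position `Sₙ = T₁ + ⋯ + Tₙ` of the walk with random step sizes. -/
def walkS {Ω : Type*} {d : ℕ} (A : ℕ → Ω → Matrix (Fin d) (Fin d) ℝ) (β : ℕ → Ω → ℕ)
    (X : ℕ → Ω → Fin d → ℝ) (Y : ℕ → Ω → ℝ) (n : ℕ) (ω : Ω) : Fin d → ℝ :=
  ∑ k ∈ Finset.Icc 1 n, walkStep A β X Y k ω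

/-- The position `Wₙ = X₁ + ⋯ + Xₙ` of the walk with unit steps. -/
def walkW {Ω : Type*} {d : ℕ} (X : ℕ → Ω → Fin d → ℝ) (n : ℕ) (ω : Ω) : Fin d → ℝ :=
  ∑ k ∈ Finset.Icc 1 n, X k ω

/-! Fix coordinates i, j and let δ_k = (Y_{k+1} − μ) X_{k+1,i}, with δ'_k the same for j. By the
recursion, S_n − μW_n has coordinates M_n = Σ_{k<n} δ_k and M'_n (`ae_walk_sub_eq`). The first
increment need not be centred. Later ones are, since each new size is independent of the past and of
the new direction.

Let Q_n be the sum of M_{k+1}M'_{k+1}/((k+1)(k+2)) over k < n, and R_n the sum of (δ_lδ'_l + M_lδ'_l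
+ M'_lδ_l)/(l+1) over l < n. Summation by parts gives Q_n + M_{n+1}M'_{n+1}/(n+1) = R_{n+1}, and one
more summation gives (n+1)Q_n = Σ_{k<n} R_{k+1} (`sum_range_mul_div_eq`). Averaging thus removes the
boundary term, and no pathwise bound on M_n is needed: it suffices that R_n is asymptotic to a
multiple of the harmonic number H_n, which is equivalent to log(n+1).

The cross terms of R_n are negligible. Divided by (l+1)H_{l+1} and started at l = 1, they are
increments of an L² martingale, because E M_l² = O(l) and Σ 1/(l H_l²) converges. Kronecker's lemma
with weights H_n concludes (`ae_tendsto_cross_term`).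

The quadratic terms give the limit. Every X_k is a signed basis vector, so off the diagonal they
vanish. On the diagonal, X_{n+1,i}² has conditional mean 2r + (p − r)·(average of the past
X_{k,i}²), r = (1−p)/(2d−1). Its logarithmic averages are driven to the fixed point 1/d
(`ae_tendsto_axis_frequency`). The factor (Y_{k+1} − μ)² is then replaced by η²: it is truncated at
level k+1, and the third moment makes both the centred truncated part and the overflow summable
after division by k+1 (`ae_tendsto_weighted_axis_frequency`). -/

/-! ### Harmonic numbers and logarithmic averages of real sequences -/

/-- The harmonic numbers as a real sequence. -/
noncomputable def harmonicSum (n : ℕ) : ℝ := ∑ k ∈ Finset.range n, 1 / ((k : ℝ) + 1)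

lemma harmonicSum_zero : harmonicSum 0 = 0 := by simp [harmonicSum]

lemma harmonicSum_succ (n : ℕ) : harmonicSum (n + 1) = harmonicSum n + 1 / ((n : ℝ) + 1) := by
  simp [harmonicSum, Finset.sum_range_succ]

lemma harmonicSum_eq (n : ℕ) : harmonicSum n = (harmonic n : ℝ) := by
  simp [harmonicSum, harmonic]

lemma monotone_harmonicSum : Monotone harmonicSum :=
  monotone_nat_of_le_succ fun n => by
    rw [harmonicSum_succ]; have : 0 ≤ 1 / ((n : ℝ) + 1) := by positivity
    linarith

lemma one_le_harmonicSum (n : ℕ) : 1 ≤ harmonicSum (n + 1) := by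
  have h := monotone_harmonicSum (Nat.le_add_left 1 n)
  simpa [harmonicSum] using h

lemma tendsto_harmonicSum : Tendsto harmonicSum atTop atTop :=
  Real.tendsto_sum_range_one_div_nat_succ_atTop

lemma tendsto_harmonicSum_div_log :
    Tendsto (fun n : ℕ => harmonicSum n / Real.log ((n : ℝ) + 1)) atTop (𝓝 1) := by
  have hlog : Tendsto (fun n : ℕ => Real.log ((n : ℝ) + 1)) atTop atTop :=
    Real.tendsto_log_atTop.comp (tendsto_atTop_add_const_right _ _ tendsto_natCast_atTop_atTop)
  have hup : Tendsto (fun n : ℕ => 1 / Real.log ((n : ℝ) + 1) + 1) atTop (𝓝 1) := by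
    simpa using (hlog.const_div_atTop 1).add_const 1
  refine tendsto_of_tendsto_of_tendsto_of_le_of_le' tendsto_const_nhds hup ?_ ?_
  · filter_upwards [hlog.eventually_gt_atTop 0] with n hn
    rw [le_div_iff₀ hn, harmonicSum_eq, one_mul]
    exact_mod_cast log_add_one_le_harmonic n
  · filter_upwards [hlog.eventually_gt_atTop 0, eventually_ge_atTop 1] with n hn h1
    rw [div_le_iff₀ hn, add_mul, one_mul, div_mul_cancel₀ _ hn.ne', harmonicSum_eq]
    refine (harmonic_le_one_add_log n).trans ?_
    have : (0 : ℝ) < n := by exact_mod_cast h1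
    gcongr
    linarith

lemma sum_range_harmonicSum_succ (n : ℕ) :
    ∑ k ∈ Finset.range n, harmonicSum (k + 1) = ((n : ℝ) + 1) * harmonicSum n - n := by
  induction n with
  | zero => simp [harmonicSum_zero]
  | succ n ih =>
    rw [Finset.sum_range_succ, ih, harmonicSum_succ]
    push_cast
    field_simp
    ring

/-- Comparison with a telescoping series: each term is at most 1/H_{n+1} − 1/H_{n+2}. This is the
variance bound for the cross terms; without the factor H² the series would diverge. -/
lemma summable_inv_mul_harmonicSum_sq :
    Summable fun n : ℕ => 1 / (((n : ℝ) + 2) * harmonicSum (n + 2) ^ 2) := by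
  refine summable_of_sum_range_le (c := 1) (fun n => by positivity) fun n => ?_
  suffices h : ∑ i ∈ Finset.range n, 1 / (((i : ℝ) + 2) * harmonicSum (i + 2) ^ 2)
      ≤ 1 - 1 / harmonicSum (n + 1) by
    have := one_le_harmonicSum n
    have : 0 ≤ 1 / harmonicSum (n + 1) := by positivity
    linarith
  induction n with
  | zero => simp [harmonicSum]
  | succ n ih =>
    rw [Finset.sum_range_succ]
    have h1 := one_le_harmonicSum n
    have h2 := one_le_harmonicSum (n + 1)
    have h3 := harmonicSum_succ (n + 1)
    push_cast at h3
    have h4 : (n : ℝ) + 1 + 1 = n + 2 := by ring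
    rw [h4] at h3
    have h5 : harmonicSum (n + 1) ≤ harmonicSum (n + 2) := monotone_harmonicSum (by omega)
    suffices 1 / (((n : ℝ) + 2) * harmonicSum (n + 2) ^ 2)
        ≤ 1 / harmonicSum (n + 1) - 1 / harmonicSum (n + 2) by
      have e : harmonicSum (n + 1 + 1) = harmonicSum (n + 2) := rfl
      rw [e]; linarith
    have h6 : 1 / ((n : ℝ) + 2) = harmonicSum (n + 2) - harmonicSum (n + 1) := by
      have e : harmonicSum (n + 1 + 1) = harmonicSum (n + 2) := rfl
      rw [e] at h3; linarith
    have h2' : 1 ≤ harmonicSum (n + 2) := h2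
    rw [← div_div, h6, div_sub_div _ _ (by positivity) (by positivity), one_mul, mul_one]
    refine div_le_div_of_nonneg_left (by linarith) (by positivity) ?_
    nlinarith

lemma tendsto_div_harmonicSum_of_tendsto {f : ℕ → ℝ} {l : ℝ} (hf : Tendsto f atTop (𝓝 l)) :
    Tendsto (fun n => f n / harmonicSum n) atTop (𝓝 0) :=
  hf.div_atTop tendsto_harmonicSum

/-- Kronecker's lemma. -/
lemma tendsto_kronecker {x b : ℕ → ℝ} {s : ℝ} (hb0 : b 0 = 0) (hb : Monotone b)
    (hbt : Tendsto b atTop atTop)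
    (hx : Tendsto (fun n => ∑ k ∈ Finset.range n, x k) atTop (𝓝 s)) :
    Tendsto (fun n => (∑ k ∈ Finset.range n, b (k + 1) * x k) / b n) atTop (𝓝 0) := by
  set S : ℕ → ℝ := fun n => ∑ k ∈ Finset.range n, x k with hS
  -- Abel summation centred at the limit `s`: what remains is a weighted mean of `S k - s`, with
  -- weights `b (k + 1) - b k` of total mass `b n`.
  have hid : ∀ n, ∑ k ∈ Finset.range n, b (k + 1) * x k
      = b n * (S n - s) - ∑ k ∈ Finset.range n, (b (k + 1) - b k) * (S k - s) := by
    intro n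
    induction n with
    | zero => simp [hb0]
    | succ n ih =>
      rw [Finset.sum_range_succ, ih, Finset.sum_range_succ]
      simp only [hS, Finset.sum_range_succ]
      ring
  have hsum : ∀ n, ∑ k ∈ Finset.range n, (b (k + 1) - b k) = b n := fun n => by
    rw [Finset.sum_range_sub, hb0, sub_zero]
  have hS0 : Tendsto (fun n => S n - s) atTop (𝓝 0) := by simpa using hx.sub_const s
  have ho : (fun k => (b (k + 1) - b k) * (S k - s)) =o[atTop] fun k => b (k + 1) - b k := by
    simpa using (Asymptotics.isBigO_refl (fun k => b (k + 1) - b k) atTop).mul_isLittleO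
      ((Asymptotics.isLittleO_one_iff ℝ).2 hS0)
  have ho' := ho.sum_range (fun k => sub_nonneg.2 (hb (Nat.le_succ k)))
    (by simpa only [hsum] using hbt)
  simp only [hsum] at ho'
  have := hS0.sub ho'.tendsto_div_nhds_zero
  rw [sub_zero] at this
  refine this.congr' ?_
  filter_upwards [hbt.eventually_gt_atTop 0] with n hn
  rw [hid, sub_div, mul_div_cancel_left₀ _ hn.ne']

lemma tendsto_sum_range_of_succ {f : ℕ → ℝ} {l : ℝ}
    (h : Tendsto (fun n => ∑ k ∈ Finset.range n, f (k + 1)) atTop (𝓝 l)) :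
    Tendsto (fun n => ∑ k ∈ Finset.range n, f k) atTop (𝓝 (l + f 0)) := by
  rw [← tendsto_add_atTop_iff_nat 1]
  simpa only [Finset.sum_range_succ'] using h.add_const (f 0)

/-- Averaging `R (k + 1)` over `k < n` preserves the growth rate `c * harmonicSum n`. -/
lemma tendsto_average_div_harmonicSum {R : ℕ → ℝ} {c : ℝ}
    (hR : Tendsto (fun n => R n / harmonicSum n) atTop (𝓝 c)) :
    Tendsto (fun n : ℕ => (∑ k ∈ Finset.range n, R (k + 1)) / ((n : ℝ) + 1) / harmonicSum n)
      atTop (𝓝 c) := by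
  have h1 : Tendsto (fun n => (R (n + 1) - c * harmonicSum (n + 1)) / harmonicSum (n + 1))
      atTop (𝓝 0) := by
    have := ((tendsto_add_atTop_iff_nat 1).2 hR).sub_const c
    rw [sub_self] at this
    refine this.congr fun n => ?_
    have := one_le_harmonicSum n
    field_simp
  have ho : (fun n => R (n + 1) - c * harmonicSum (n + 1)) =o[atTop]
      fun n => harmonicSum (n + 1) :=
    (Asymptotics.isLittleO_iff_tendsto fun n h => absurd h
      (by have := one_le_harmonicSum n; positivity)).2 h1
  have hpos : ∀ n, 0 ≤ harmonicSum (n + 1) := fun n => zero_le_one.trans (one_le_harmonicSum n)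
  have hlow : ∀ n : ℕ, (n : ℝ) ≤ ∑ k ∈ Finset.range n, harmonicSum (k + 1) := fun n => by
    simpa using Finset.card_nsmul_le_sum (Finset.range n) _ 1 fun k _ => one_le_harmonicSum k
  have hs := ho.sum_range hpos (tendsto_atTop_mono hlow tendsto_natCast_atTop_atTop)
  have hb : (fun n : ℕ => ∑ k ∈ Finset.range n, harmonicSum (k + 1)) =O[atTop]
      fun n : ℕ => ((n : ℝ) + 1) * harmonicSum n := by
    refine Asymptotics.IsBigO.of_bound 1 (Eventually.of_forall fun n => ?_)
    rw [Real.norm_of_nonneg (Finset.sum_nonneg fun k _ => hpos k), one_mul,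
      sum_range_harmonicSum_succ]
    exact (sub_le_self _ n.cast_nonneg).trans (le_abs_self _)
  have ht := (hs.trans_isBigO hb).tendsto_div_nhds_zero
  -- The sum of H_{k+1} over k < n is (n+1)H_n − n, so after division by (n+1)H_n the discrepancy
  -- from 1 is this quantity.
  have h2 : Tendsto (fun n : ℕ => ((n : ℝ) / (n + 1)) * (harmonicSum n)⁻¹) atTop (𝓝 0) := by
    simpa using (tendsto_natCast_div_add_atTop (1 : ℝ)).mul tendsto_harmonicSum.inv_tendsto_atTop
  have h3 := (ht.add_const c).sub (h2.const_mul c)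
  simp only [zero_add, mul_zero, sub_zero] at h3
  refine h3.congr' ?_
  filter_upwards [tendsto_harmonicSum.eventually_gt_atTop 0] with n hn
  rw [Finset.sum_sub_distrib, ← Finset.mul_sum, sum_range_harmonicSum_succ]
  field_simp
  ring

/-- Two summations by parts. With Q_n the sum on the left and R_n the inner sum on the right,
(n+2)Q_{n+1} − (n+1)Q_n = Q_n + M_{n+1}M'_{n+1}/(n+1), which `key` identifies with R_{n+1}. -/
lemma sum_range_mul_div_eq (δ δ' : ℕ → ℝ) (n : ℕ) :
    ((n : ℝ) + 1) * ∑ k ∈ Finset.range n, ((∑ l ∈ Finset.range (k + 1), δ l) *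
        ∑ l ∈ Finset.range (k + 1), δ' l) / (((k : ℝ) + 1) * ((k : ℝ) + 2))
      = ∑ k ∈ Finset.range n, ∑ l ∈ Finset.range (k + 1),
        (δ l * δ' l + (∑ i ∈ Finset.range l, δ i) * δ' l
          + (∑ i ∈ Finset.range l, δ' i) * δ l) / ((l : ℝ) + 1) := by
  -- The increment of M M' is δδ' + Mδ' + M'δ, and 1/(k+1) − 1/(k+2) = 1/((k+1)(k+2)).
  have key : ∀ n : ℕ, ∑ k ∈ Finset.range n, ((∑ l ∈ Finset.range (k + 1), δ l) *
        ∑ l ∈ Finset.range (k + 1), δ' l) / (((k : ℝ) + 1) * ((k : ℝ) + 2))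
        + ((∑ l ∈ Finset.range (n + 1), δ l) * ∑ l ∈ Finset.range (n + 1), δ' l) / ((n : ℝ) + 1)
      = ∑ l ∈ Finset.range (n + 1), (δ l * δ' l + (∑ i ∈ Finset.range l, δ i) * δ' l
          + (∑ i ∈ Finset.range l, δ' i) * δ l) / ((l : ℝ) + 1) := by
    intro n
    induction n with
    | zero => simp
    | succ n ih =>
      have hs := Finset.sum_range_succ (fun l => (δ l * δ' l + (∑ i ∈ Finset.range l, δ i) * δ' l
          + (∑ i ∈ Finset.range l, δ' i) * δ l) / ((l : ℝ) + 1)) (n + 1)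
      have hs' := Finset.sum_range_succ (fun k : ℕ => ((∑ l ∈ Finset.range (k + 1), δ l) *
        ∑ l ∈ Finset.range (k + 1), δ' l) / (((k : ℝ) + 1) * ((k : ℝ) + 2))) n
      rw [hs, ← ih, hs']
      rw [Finset.sum_range_succ δ (n + 1), Finset.sum_range_succ δ' (n + 1)]
      generalize ∑ l ∈ Finset.range (n + 1), δ l = x
      generalize ∑ l ∈ Finset.range (n + 1), δ' l = y
      push_cast
      field_simp
      ring
  induction n with
  | zero => simp
  | succ n ih =>
    have hs := Finset.sum_range_succ (fun k => ∑ l ∈ Finset.range (k + 1),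
        (δ l * δ' l + (∑ i ∈ Finset.range l, δ i) * δ' l
          + (∑ i ∈ Finset.range l, δ' i) * δ l) / ((l : ℝ) + 1)) n
    have hs' := Finset.sum_range_succ (fun k : ℕ => ((∑ l ∈ Finset.range (k + 1), δ l) *
        ∑ l ∈ Finset.range (k + 1), δ' l) / (((k : ℝ) + 1) * ((k : ℝ) + 2))) n
    rw [hs, hs', ← ih, ← key n]
    push_cast
    field_simp
    ring

/-- The deterministic part of the quadratic strong law. -/
lemma tendsto_quadratic_strong_law {δ δ' : ℕ → ℝ} {c : ℝ}
    (h1 : Tendsto (fun n => (∑ k ∈ Finset.range n, δ k * δ' k / ((k : ℝ) + 1)) / harmonicSum n)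
      atTop (𝓝 c))
    (h2 : Tendsto (fun n => (∑ k ∈ Finset.range n,
      (∑ i ∈ Finset.range k, δ i) * δ' k / ((k : ℝ) + 1)) / harmonicSum n) atTop (𝓝 0))
    (h3 : Tendsto (fun n => (∑ k ∈ Finset.range n,
      (∑ i ∈ Finset.range k, δ' i) * δ k / ((k : ℝ) + 1)) / harmonicSum n) atTop (𝓝 0)) :
    Tendsto (fun n : ℕ => (∑ k ∈ Finset.range n, ((∑ l ∈ Finset.range (k + 1), δ l) *
        ∑ l ∈ Finset.range (k + 1), δ' l) / (((k : ℝ) + 1) * ((k : ℝ) + 2)))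
        / Real.log ((n : ℝ) + 1)) atTop (𝓝 c) := by
  have h := (h1.add h2).add h3
  simp only [add_zero, ← add_div, ← Finset.sum_add_distrib] at h
  have h' := (tendsto_average_div_harmonicSum h).mul tendsto_harmonicSum_div_log
  rw [mul_one] at h'
  refine h'.congr' ?_
  filter_upwards [tendsto_harmonicSum.eventually_gt_atTop 0] with n hn
  rw [← sum_range_mul_div_eq δ δ' n]
  field_simp

lemma sum_range_average_eq (u : ℕ → ℝ) (n : ℕ) :
    ∑ k ∈ Finset.range n, (∑ l ∈ Finset.range (k + 1), u l) / (((k : ℝ) + 1) * ((k : ℝ) + 2))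
      = ∑ k ∈ Finset.range n, u k / ((k : ℝ) + 1) - (∑ k ∈ Finset.range n, u k) / ((n : ℝ) + 1) := by
  induction n with
  | zero => simp
  | succ n ih =>
    rw [Finset.sum_range_succ _ n, ih, Finset.sum_range_succ _ n,
      Finset.sum_range_succ _ n]
    push_cast
    field_simp
    ring

/-- If the increments of `u` are asymptotically an affine function of its averages, the
logarithmic averages of `u` converge to the fixed point. -/
lemma tendsto_log_average_of_affine {u : ℕ → ℝ} {q a l : ℝ} (ha : a ≠ 1)
    (hu0 : ∀ k, 0 ≤ u k) (hu1 : ∀ k, u k ≤ 1)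
    (h : Tendsto (fun n => ∑ k ∈ Finset.range n,
      (u (k + 1) - q - a * ((∑ i ∈ Finset.range (k + 1), u i) / ((k : ℝ) + 1))) / ((k : ℝ) + 2))
      atTop (𝓝 l)) :
    Tendsto (fun n => (∑ k ∈ Finset.range n, u k / ((k : ℝ) + 1)) / harmonicSum n) atTop
      (𝓝 (q / (1 - a))) := by
  rw [← tendsto_add_atTop_iff_nat 1]
  -- Up to bounded terms, the logarithmic sum of the averages equals that of `u`, by
  -- `sum_range_average_eq`. Hence the affine relation becomes (1 − a)·(log sum of `u`) = q·H + a
  -- remainder that is o(H).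
  have hid : ∀ n : ℕ, (1 - a) * ∑ k ∈ Finset.range (n + 1), u k / ((k : ℝ) + 1)
      = q * harmonicSum (n + 1) + (∑ k ∈ Finset.range n,
      (u (k + 1) - q - a * ((∑ i ∈ Finset.range (k + 1), u i) / ((k : ℝ) + 1))) / ((k : ℝ) + 2)
        + (u 0 - q) - a * ((∑ k ∈ Finset.range (n + 1), u k) / ((n : ℝ) + 1))) := by
    intro n
    have e1 : ∑ k ∈ Finset.range n,
      (u (k + 1) - q - a * ((∑ i ∈ Finset.range (k + 1), u i) / ((k : ℝ) + 1))) / ((k : ℝ) + 2)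
      = ∑ k ∈ Finset.range n, u (k + 1) / ((k : ℝ) + 2)
        - q * ∑ k ∈ Finset.range n, 1 / ((k : ℝ) + 2)
        - a * ∑ k ∈ Finset.range n,
          (∑ l ∈ Finset.range (k + 1), u l) / (((k : ℝ) + 1) * ((k : ℝ) + 2)) := by
      rw [Finset.mul_sum, Finset.mul_sum, ← Finset.sum_sub_distrib, ← Finset.sum_sub_distrib]
      refine Finset.sum_congr rfl fun k _ => ?_
      field_simp
    have e2 : ∑ k ∈ Finset.range (n + 1), u k / ((k : ℝ) + 1)
        = ∑ k ∈ Finset.range n, u (k + 1) / ((k : ℝ) + 2) + u 0 := by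
      rw [Finset.sum_range_succ']
      norm_num [add_assoc]
    have e3 : harmonicSum (n + 1) = ∑ k ∈ Finset.range n, 1 / ((k : ℝ) + 2) + 1 := by
      rw [harmonicSum, Finset.sum_range_succ']
      norm_num [add_assoc]
    have e4 := Finset.sum_range_succ (fun k => u k / ((k : ℝ) + 1)) n
    rw [e1, sum_range_average_eq, e3, Finset.sum_range_succ u n, add_div]
    linear_combination e2 - a * e4
  have hz : Tendsto (fun n => (∑ k ∈ Finset.range n,
      (u (k + 1) - q - a * ((∑ i ∈ Finset.range (k + 1), u i) / ((k : ℝ) + 1))) / ((k : ℝ) + 2)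
        + (u 0 - q)) / harmonicSum (n + 1)) atTop (𝓝 0) :=
    (h.add_const _).div_atTop ((tendsto_add_atTop_iff_nat 1).2 tendsto_harmonicSum)
  have hw : Tendsto (fun n : ℕ => a * ((∑ k ∈ Finset.range (n + 1), u k) / ((n : ℝ) + 1))
      / harmonicSum (n + 1)) atTop (𝓝 0) := by
    have hi := ((tendsto_add_atTop_iff_nat 1).2 tendsto_harmonicSum).inv_tendsto_atTop.const_mul |a|
    rw [mul_zero] at hi
    refine squeeze_zero_norm (fun n => ?_) hi
    have hp : 0 < harmonicSum (n + 1) := zero_lt_one.trans_le (one_le_harmonicSum n)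
    have hs0 : 0 ≤ (∑ k ∈ Finset.range (n + 1), u k) / ((n : ℝ) + 1) :=
      div_nonneg (Finset.sum_nonneg fun k _ => hu0 k) (by positivity)
    have hs1 : (∑ k ∈ Finset.range (n + 1), u k) / ((n : ℝ) + 1) ≤ 1 := by
      rw [div_le_one (by positivity)]
      simpa using Finset.sum_le_card_nsmul (Finset.range (n + 1)) u 1 fun k _ => hu1 k
    rw [norm_div, norm_mul, Real.norm_eq_abs, Real.norm_of_nonneg hs0, Real.norm_of_nonneg hp.le,
      div_eq_mul_inv, Pi.inv_apply]
    gcongr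
    exact mul_le_of_le_one_right (abs_nonneg a) hs1
  have ha' : 1 - a ≠ 0 := sub_ne_zero.2 ha.symm
  have := ((hz.sub hw).const_add q).div_const (1 - a)
  rw [sub_zero, add_zero] at this
  refine this.congr fun n => ?_
  have hp : 0 < harmonicSum (n + 1) := zero_lt_one.trans_le (one_le_harmonicSum n)
  have := hid n
  rw [← sub_div, div_eq_div_iff ha' hp.ne', add_mul, div_mul_cancel₀ _ hp.ne']
  linear_combination -this

/-- Replacing weights by a sequence whose centred log-weighted sums converge. -/
lemma tendsto_log_average_mul {u w c : ℕ → ℝ} {l e v : ℝ}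
    (hu0 : ∀ k, 0 ≤ u k) (hu1 : ∀ k, u k ≤ 1) (hc : Tendsto c atTop (𝓝 v))
    (hw : Tendsto (fun n => ∑ k ∈ Finset.range n, (w k - c k) * u k / ((k : ℝ) + 1)) atTop (𝓝 e))
    (hu : Tendsto (fun n => (∑ k ∈ Finset.range n, u k / ((k : ℝ) + 1)) / harmonicSum n) atTop
      (𝓝 l)) :
    Tendsto (fun n => (∑ k ∈ Finset.range n, w k * u k / ((k : ℝ) + 1)) / harmonicSum n) atTop
      (𝓝 (v * l)) := by
  -- Weighted Cesàro: `c k - v` tends to zero and the weights 1/(k+1) have divergent sum.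
  have ho : (fun k : ℕ => (c k - v) * (u k / ((k : ℝ) + 1))) =o[atTop]
      fun k : ℕ => 1 / ((k : ℝ) + 1) := by
    have h1 : (fun k => c k - v) =o[atTop] fun _ => (1 : ℝ) :=
      (Asymptotics.isLittleO_one_iff ℝ).2 (by simpa using hc.sub_const v)
    have h2 : (fun k : ℕ => u k / ((k : ℝ) + 1)) =O[atTop] fun k : ℕ => 1 / ((k : ℝ) + 1) := by
      refine Asymptotics.IsBigO.of_bound 1 (Eventually.of_forall fun k => ?_)
      rw [Real.norm_of_nonneg (div_nonneg (hu0 k) (by positivity)),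
        Real.norm_of_nonneg (by positivity), one_mul]
      gcongr
      exact hu1 k
    simpa using h1.mul_isBigO h2
  have hs := (ho.sum_range (fun k => by positivity) tendsto_harmonicSum).tendsto_div_nhds_zero
  have := ((tendsto_div_harmonicSum_of_tendsto hw).add hs).add (hu.const_mul v)
  rw [zero_add, zero_add] at this
  refine this.congr fun n => ?_
  change _ / harmonicSum n + _ / harmonicSum n + _ = _
  rw [← mul_div_assoc, ← add_div, ← add_div, Finset.mul_sum, ← Finset.sum_add_distrib,
    ← Finset.sum_add_distrib]
  congr 1
  refine Finset.sum_congr rfl fun k _ => ?_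
  ring

/-! ### Almost sure convergence and finitely supported laws -/

/-- Convergence of a martingale whose increments have summable variances. -/
lemma ae_exists_tendsto_sum_of_orthogonal {Ω : Type*} {m0 : MeasurableSpace Ω} {P : Measure Ω}
    [IsProbabilityMeasure P] (ℱ : Filtration ℕ m0) {D : ℕ → Ω → ℝ}
    (hmeas : ∀ k, Measurable[ℱ (k + 1)] (D k)) (hL2 : ∀ k, MemLp (D k) 2 P)
    (hint : ∀ k s, MeasurableSet[ℱ k] s → ∫ ω in s, D k ω ∂P = 0)
    (hsum : Summable fun k => ∫ ω, D k ω ^ 2 ∂P) :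
    ∀ᵐ ω ∂P, ∃ l, Tendsto (fun n => ∑ k ∈ Finset.range n, D k ω) atTop (𝓝 l) := by
  set Z : ℕ → Ω → ℝ := fun n ω => ∑ k ∈ Finset.range n, D k ω with hZ
  have hZmeas : ∀ n, StronglyMeasurable[ℱ n] (Z n) := fun n => by
    refine Measurable.stronglyMeasurable ?_
    refine Finset.measurable_fun_sum _ fun k hk => ?_
    exact (hmeas k).mono (ℱ.mono (Finset.mem_range.1 hk)) le_rfl
  have hZL2 : ∀ n, MemLp (Z n) 2 P := fun n => memLp_finsetSum _ fun k _ => hL2 k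
  have hZint : ∀ n, Integrable (Z n) P := fun n => (hZL2 n).integrable one_le_two
  have hDint : ∀ n, Integrable (D n) P := fun n => (hL2 n).integrable one_le_two
  have hZsucc : ∀ n, Z (n + 1) = Z n + D n := fun n => by
    ext ω; simp [hZ, Finset.sum_range_succ]
  have hmart : Martingale Z ℱ P := by
    refine martingale_of_setIntegral_eq_succ hZmeas hZint fun n s hs => ?_
    rw [hZsucc, integral_add' (hZint n).integrableOn (hDint n).integrableOn, hint n s hs, add_zero]
  have hcond : ∀ n, P[D n | ℱ n] =ᵐ[P] 0 := fun n => by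
    refine (ae_eq_condExp_of_forall_setIntegral_eq (ℱ.le n) (hDint n)
      (fun s _ _ => (integrable_zero _ _ _).integrableOn) (fun s hs _ => ?_)
      stronglyMeasurable_zero.aestronglyMeasurable).symm
    rw [hint n s hs]; simp
  have horth : ∀ n, ∫ ω, Z n ω * D n ω ∂P = 0 := fun n => by
    have hi : Integrable (Z n * D n) P := (hZL2 n).integrable_mul (hL2 n)
    have h := condExp_mul_of_stronglyMeasurable_left (hZmeas n) hi (hDint n)
    have h0 : P[Z n * D n | ℱ n] =ᵐ[P] 0 := by
      filter_upwards [h, hcond n] with ω h1 h2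
      simp [h1, h2]
    change ∫ ω, (Z n * D n) ω ∂P = 0
    rw [← integral_condExp (ℱ.le n), integral_congr_ae h0]
    simp
  have hsq : ∀ n, ∫ ω, Z n ω ^ 2 ∂P = ∑ k ∈ Finset.range n, ∫ ω, D k ω ^ 2 ∂P := fun n => by
    induction n with
    | zero => simp [hZ]
    | succ n ih =>
      rw [Finset.sum_range_succ, ← ih, hZsucc]
      have e : (fun ω => (Z n + D n) ω ^ 2)
          = fun ω => (Z n ω ^ 2 + D n ω ^ 2) + 2 * (Z n ω * D n ω) := by
        ext ω; simp only [Pi.add_apply]; ring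
      rw [e, integral_add, integral_add, integral_const_mul, horth]
      · ring
      · exact (hZL2 n).integrable_sq
      · exact (hL2 n).integrable_sq
      · exact (hZL2 n).integrable_sq.add (hL2 n).integrable_sq
      · exact ((hZL2 n).integrable_mul (hL2 n)).const_mul 2
  -- Orthogonality bounds the second moments; |z| ≤ 1 + z² turns this into the L¹ bound required by
  -- the martingale convergence theorem.
  have hbound : ∀ n, eLpNorm (Z n) 1 P ≤ ((1 + ∑' k, ∫ ω, D k ω ^ 2 ∂P).toNNReal : NNReal) := by
    intro n
    rw [eLpNorm_one_eq_lintegral_enorm, ← ofReal_integral_norm_eq_lintegral_enorm (hZint n)]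
    refine ENNReal.ofReal_le_ofReal ?_
    calc ∫ ω, ‖Z n ω‖ ∂P ≤ ∫ ω, (1 + Z n ω ^ 2) ∂P := by
          refine integral_mono (hZint n).norm
            ((integrable_const _).add (hZL2 n).integrable_sq) fun ω => ?_
          have := sq_nonneg (|Z n ω| - 1)
          have h2 := sq_abs (Z n ω)
          simp only [Real.norm_eq_abs]
          nlinarith [abs_nonneg (Z n ω)]
      _ = 1 + ∑ k ∈ Finset.range n, ∫ ω, D k ω ^ 2 ∂P := by
          rw [integral_add (integrable_const _) (hZL2 n).integrable_sq, hsq]; simp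
      _ ≤ _ := by
          gcongr
          exact hsum.sum_le_tsum _ fun k _ => integral_nonneg fun ω => sq_nonneg _
  filter_upwards [hmart.submartingale.ae_tendsto_limitProcess hbound] with ω hω
  exact ⟨_, hω⟩

/-- Tonelli: the sum has finite expectation, hence is finite almost surely. -/
lemma ae_summable_of_summable_integral {Ω : Type*} {m0 : MeasurableSpace Ω} {P : Measure Ω}
    {f : ℕ → Ω → ℝ} (hf : ∀ k, Integrable (f k) P) (h0 : ∀ k, 0 ≤ᵐ[P] f k)
    (hsum : Summable fun k => ∫ ω, f k ω ∂P) : ∀ᵐ ω ∂P, Summable fun k => f k ω := by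
  have h0' : ∀ᵐ ω ∂P, ∀ k, 0 ≤ f k ω := ae_all_iff.2 h0
  have hlt : ∫⁻ ω, ∑' k, ENNReal.ofReal (f k ω) ∂P ≠ ⊤ := by
    rw [lintegral_tsum fun k => (hf k).aestronglyMeasurable.aemeasurable.ennreal_ofReal]
    simp_rw [← ofReal_integral_eq_lintegral_ofReal (hf _) (h0 _)]
    exact hsum.tsum_ofReal_ne_top
  have hm : AEMeasurable (fun ω => ∑' k, ENNReal.ofReal (f k ω)) P :=
    AEMeasurable.tsum fun k => (hf k).aestronglyMeasurable.aemeasurable.ennreal_ofReal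
  filter_upwards [ae_lt_top' hm hlt, h0'] with ω h1 h2
  have := ENNReal.summable_toReal h1.ne
  simpa only [ENNReal.toReal_ofReal (h2 _)] using this

/-- A random variable with finitely many atoms of total mass one. -/
lemma ae_mem_range_of_sum_eq_one {Ω E ι : Type*} {m0 : MeasurableSpace Ω} {P : Measure Ω}
    [IsProbabilityMeasure P] [MeasurableSpace E] [MeasurableSingletonClass E]
    {Z : Ω → E} (hZ : Measurable Z) (s : Finset ι) {V : ι → E} (hV : Set.InjOn V s)
    (hsum : ∑ i ∈ s, P.real {ω | Z ω = V i} = 1) : ∀ᵐ ω ∂P, ∃ i ∈ s, Z ω = V i := by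
  have hm : ∀ i, MeasurableSet {ω | Z ω = V i} := fun i => hZ (measurableSet_singleton (V i))
  have hd : Set.PairwiseDisjoint (↑s) fun i => {ω | Z ω = V i} := fun i hi j hj hij =>
    Set.disjoint_left.2 fun ω h1 h2 => hij (hV hi hj (h1.symm.trans h2))
  have h := measureReal_biUnion_finset (μ := P) hd fun i _ => hm i
  rw [hsum] at h
  have h' : P (⋃ i ∈ s, {ω | Z ω = V i}) = 1 := by
    rw [measureReal_def] at h
    exact (ENNReal.toReal_eq_one_iff _).1 h
  have := (prob_compl_eq_zero_iff (s.measurableSet_biUnion fun i _ => hm i)).2 h'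
  filter_upwards [compl_mem_ae_iff.2 this] with ω hω
  simpa using hω

lemma integral_comp_of_sum_eq_one {Ω E ι : Type*} {m0 : MeasurableSpace Ω} {P : Measure Ω}
    [IsProbabilityMeasure P] [MeasurableSpace E] [MeasurableSingletonClass E]
    {Z : Ω → E} (hZ : Measurable Z) (s : Finset ι) {V : ι → E} (hV : Set.InjOn V s)
    (hsum : ∑ i ∈ s, P.real {ω | Z ω = V i} = 1) (f : E → ℝ) :
    ∫ ω, f (Z ω) ∂P = ∑ i ∈ s, P.real {ω | Z ω = V i} * f (V i) := by
  have hm : ∀ i, MeasurableSet {ω | Z ω = V i} := fun i => hZ (measurableSet_singleton (V i))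
  have h : (fun ω => f (Z ω)) =ᵐ[P]
      fun ω => ∑ i ∈ s, {ω | Z ω = V i}.indicator (fun _ => f (V i)) ω := by
    filter_upwards [ae_mem_range_of_sum_eq_one hZ s hV hsum] with ω ⟨i, hi, hω⟩
    rw [Finset.sum_eq_single_of_mem i hi]
    · simp [Set.indicator, hω]
    · intro j hj hji
      have : Z ω ≠ V j := fun e => hji (hV hj hi (e.symm.trans hω))
      simp [Set.indicator, this]
  rw [integral_congr_ae h, integral_finsetSum]
  · refine Finset.sum_congr rfl fun i _ => ?_
    rw [integral_indicator_const _ (hm i), smul_eq_mul]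
  · exact fun i _ => (integrable_const _).indicator (hm i)

/-! ### Signed cyclic shifts and axis vectors -/

instance matrixMeasurableSingletonClass (d : ℕ) :
    MeasurableSingletonClass (Matrix (Fin d) (Fin d) ℝ) :=
  inferInstanceAs (MeasurableSingletonClass (Fin d → Fin d → ℝ))

lemma measurable_matrix_entry {d : ℕ} (i j : Fin d) :
    Measurable fun M : Matrix (Fin d) (Fin d) ℝ => M i j :=
  (measurable_pi_apply j).comp (measurable_pi_apply (X := fun _ : Fin d => Fin d → ℝ) i)

lemma shiftMatrix_mulVec {d : ℕ} [NeZero d] (x : Fin d → ℝ) :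
    shiftMatrix d *ᵥ x = fun i => x (i + Fin.ofNat d 1) := by
  ext i
  have h : ∀ j : Fin d, (j : ℕ) = ((i : ℕ) + 1) % d ↔ j = i + Fin.ofNat d 1 := fun j => by
    rw [Fin.ext_iff, Fin.val_add]; simp
  simp [shiftMatrix, Matrix.mulVec, dotProduct, h]

lemma shiftMatrix_pow_mulVec {d : ℕ} [NeZero d] (k : ℕ) (x : Fin d → ℝ) :
    shiftMatrix d ^ k *ᵥ x = fun i => x (i + Fin.ofNat d k) := by
  induction k generalizing x with
  | zero => ext i; simp
  | succ k ih =>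
    rw [pow_succ, ← Matrix.mulVec_mulVec, ih, shiftMatrix_mulVec]
    ext i
    refine congrArg x (Fin.ext ?_)
    simp [Fin.val_add, add_assoc]

lemma shiftMatrix_pow_apply {d : ℕ} [NeZero d] (k : ℕ) (i j : Fin d) :
    (shiftMatrix d ^ k) i j = if i + Fin.ofNat d k = j then 1 else 0 := by
  have h := congrFun (shiftMatrix_pow_mulVec k (Pi.single j (1 : ℝ))) i
  rw [Matrix.mulVec_single_one] at h
  simpa [Pi.single_apply] using h

/-- The matrices `± J_d ^ k`. -/
noncomputable def signedShift {d : ℕ} (x : Fin d × Bool) : Matrix (Fin d) (Fin d) ℝ :=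
  (if x.2 then (1 : ℝ) else -1) • shiftMatrix d ^ (x.1 : ℕ)

lemma signedShift_apply {d : ℕ} [NeZero d] (x : Fin d × Bool) (i j : Fin d) :
    signedShift x i j = if i + x.1 = j then (if x.2 then (1 : ℝ) else -1) else 0 := by
  simp [signedShift, shiftMatrix_pow_apply]

lemma signedShift_injective {d : ℕ} [NeZero d] :
    Function.Injective (signedShift : Fin d × Bool → Matrix (Fin d) (Fin d) ℝ) := by
  rintro ⟨k, s⟩ ⟨l, t⟩ h
  -- The only nonzero entry of row 0 of a signed shift is in the column given by the shift, and its
  -- value is the sign; so this one row identifies both.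
  have h1 := congrFun (congrFun h 0) k
  rw [signedShift_apply, signedShift_apply] at h1
  simp only [zero_add, if_true] at h1
  by_cases hkl : l = k
  · subst hkl
    cases s <;> cases t <;> first | rfl | norm_num at h1
  · cases s <;> simp [hkl] at h1

lemma signedShift_apply_sq {d : ℕ} [NeZero d] (x : Fin d × Bool) (i j : Fin d) :
    signedShift x i j ^ 2 = if x.1 = j - i then 1 else 0 := by
  have : i + x.1 = j ↔ x.1 = j - i := by rw [eq_sub_iff_add_eq, add_comm]
  rw [signedShift_apply]
  simp only [this]
  split_ifs <;> norm_num

lemma signedShift_mulVec {d : ℕ} [NeZero d] (k : Fin d × Bool) (x : Fin d → ℝ) :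
    signedShift k *ᵥ x = fun i => (if k.2 then (1 : ℝ) else -1) * x (i + k.1) := by
  rw [signedShift, Matrix.smul_mulVec, shiftMatrix_pow_mulVec]
  ext i
  simp

/-- Unit vectors with at most one nonzero coordinate. -/
def IsAxisVector {d : ℕ} (x : Fin d → ℝ) : Prop :=
  ∑ j, x j ^ 2 = 1 ∧ ∀ i j, i ≠ j → x i * x j = 0

lemma IsAxisVector.sq_le_one {d : ℕ} {x : Fin d → ℝ} (hx : IsAxisVector x) (i : Fin d) :
    x i ^ 2 ≤ 1 :=
  hx.1 ▸ Finset.single_le_sum (f := fun j => x j ^ 2) (fun _ _ => sq_nonneg _) (Finset.mem_univ i)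

lemma IsAxisVector.abs_le_one {d : ℕ} {x : Fin d → ℝ} (hx : IsAxisVector x) (i : Fin d) :
    |x i| ≤ 1 :=
  (sq_le_one_iff_abs_le_one _).1 (hx.sq_le_one i)

lemma IsAxisVector.signedShift_mulVec {d : ℕ} [NeZero d] {x : Fin d → ℝ} (hx : IsAxisVector x)
    (k : Fin d × Bool) : IsAxisVector (signedShift k *ᵥ x) := by
  have hs : (if k.2 then (1 : ℝ) else -1) ^ 2 = 1 := by split_ifs <;> norm_num
  rw [_root_.signedShift_mulVec]
  constructor
  · simp only [mul_pow, hs, one_mul]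
    rw [← hx.1]
    exact Equiv.sum_comp (Equiv.addRight k.1) fun j => x j ^ 2
  · intro i j hij
    rw [mul_mul_mul_comm, hx.2 _ _ fun h => hij (add_right_cancel h), mul_zero]

lemma isAxisVector_single {d : ℕ} (i : Fin d) {c : ℝ} (hc : c ^ 2 = 1) :
    IsAxisVector (c • (Pi.single i 1 : Fin d → ℝ)) := by
  constructor
  · simp [hc, Pi.single_apply]
  · intro j k hjk
    by_cases h : j = i
    · subst h
      simp [hjk.symm]
    · simp [Pi.single_apply, h]

/-- The mixed terms of the square vanish. Squared coordinates therefore evolve linearly, which makes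
their conditional expectation computable from the second moments of the matrix entries. -/
lemma IsAxisVector.mulVec_sq {d : ℕ} {x : Fin d → ℝ} (hx : IsAxisVector x)
    (M : Matrix (Fin d) (Fin d) ℝ) (i : Fin d) :
    (M *ᵥ x) i ^ 2 = ∑ j, M i j ^ 2 * x j ^ 2 := by
  simp only [Matrix.mulVec, dotProduct]
  rw [sq, Finset.sum_mul_sum]
  refine Finset.sum_congr rfl fun j _ => ?_
  rw [Finset.sum_eq_single j]
  · ring
  · intro k _ hk
    rw [mul_mul_mul_comm, hx.2 _ _ hk.symm, mul_zero]
  · simp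

lemma measurable_step_pastSigma {Ω : Type*} {d : ℕ} {X : ℕ → Ω → Fin d → ℝ}
    {Y : ℕ → Ω → ℝ} {n k : ℕ} (hk : k ∈ Finset.Icc 1 n) :
    Measurable[pastSigma X Y n] (X k) :=
  (comap_measurable (X k)).mono (le_sup_left.trans (le_iSup₂_of_le k hk le_rfl)) le_rfl

lemma measurable_size_pastSigma {Ω : Type*} {d : ℕ} {X : ℕ → Ω → Fin d → ℝ}
    {Y : ℕ → Ω → ℝ} {n k : ℕ} (hk : k ∈ Finset.Icc 1 n) :
    Measurable[pastSigma X Y n] (Y k) :=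
  (comap_measurable (Y k)).mono (le_sup_right.trans (le_iSup₂_of_le k hk le_rfl)) le_rfl

/-! ### Laws of the random choices and shape of the directions -/

namespace IsElephantWalk

variable {Ω : Type*} [MeasurableSpace Ω] {P : Measure Ω} {d : ℕ}
  {p μ η : ℝ} {A : ℕ → Ω → Matrix (Fin d) (Fin d) ℝ} {β : ℕ → Ω → ℕ}
  {X : ℕ → Ω → Fin d → ℝ} {Y : ℕ → Ω → ℝ}

lemma real_A_eq [NeZero d] (h : IsElephantWalk P d p μ η A β X Y) {n : ℕ} (hn : 1 ≤ n)
    (x : Fin d × Bool) : P.real {ω | A (n + 1) ω = signedShift x}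
      = (if x.1 = 0 then (if x.2 then p else (1 - p) / (2 * (d : ℝ) - 1))
        else (1 - p) / (2 * (d : ℝ) - 1)) := by
  obtain ⟨k, s⟩ := x
  by_cases hk : k = 0
  · subst hk
    cases s
    · simpa [signedShift] using h.law_A_neg_one n hn
    · simpa [signedShift] using h.law_A_one n hn
  · have hk1 : 1 ≤ (k : ℕ) := Nat.one_le_iff_ne_zero.2 fun e => hk (Fin.ext (by simpa using e))
    cases s
    · simpa [signedShift, hk] using h.law_A_neg_pow n hn k hk1 k.2
    · simpa [signedShift, hk] using h.law_A_pow n hn k hk1 k.2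

lemma sum_real_A [NeZero d] (h : IsElephantWalk P d p μ η A β X Y) {n : ℕ} (hn : 1 ≤ n) :
    ∑ x : Fin d × Bool, P.real {ω | A (n + 1) ω = signedShift x} = 1 := by
  have hd : (1 : ℝ) ≤ d := by exact_mod_cast Nat.one_le_iff_ne_zero.2 (NeZero.ne d)
  have hd' : 2 * (d : ℝ) - 1 ≠ 0 := by linarith
  simp only [h.real_A_eq hn, Fintype.sum_prod_type, Fintype.sum_bool, if_true,
    Bool.false_eq_true, if_false, ite_self, Finset.sum_add_distrib]
  have e : ∀ k : Fin d, (if k = 0 then p else (1 - p) / (2 * (d : ℝ) - 1))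
      = (1 - p) / (2 * (d : ℝ) - 1) + if k = 0 then p - (1 - p) / (2 * (d : ℝ) - 1) else 0 :=
    fun k => by split_ifs <;> ring
  simp only [e, Finset.sum_add_distrib, Finset.sum_ite_eq', Finset.sum_const, Finset.card_univ,
    Fintype.card_fin, nsmul_eq_mul, Finset.mem_univ, if_true]
  linear_combination (1 - p) * mul_inv_cancel₀ hd'

lemma ae_A [IsProbabilityMeasure P] [NeZero d] (h : IsElephantWalk P d p μ η A β X Y) {n : ℕ} (hn : 1 ≤ n) :
    ∀ᵐ ω ∂P, ∃ x : Fin d × Bool, A (n + 1) ω = signedShift x := by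
  simpa using ae_mem_range_of_sum_eq_one (h.measurable_A n hn) Finset.univ
    signedShift_injective.injOn (h.sum_real_A hn)

/-- Only the two signs of the shift by j − i contribute: total mass p + r if i = j and 2r otherwise,
r being the common mass of the non-identity atoms. -/
lemma integral_A_sq [IsProbabilityMeasure P] [NeZero d] (h : IsElephantWalk P d p μ η A β X Y) {n : ℕ} (hn : 1 ≤ n)
    (i j : Fin d) : ∫ ω, A (n + 1) ω i j ^ 2 ∂P
      = 2 * ((1 - p) / (2 * (d : ℝ) - 1))
        + if i = j then p - (1 - p) / (2 * (d : ℝ) - 1) else 0 := by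
  rw [integral_comp_of_sum_eq_one (h.measurable_A n hn) Finset.univ
    signedShift_injective.injOn (h.sum_real_A hn) fun M => M i j ^ 2]
  simp only [h.real_A_eq hn, signedShift_apply_sq, Fintype.sum_prod_type, Fintype.sum_bool,
    if_true, Bool.false_eq_true, if_false, ite_self, mul_ite, mul_one, mul_zero,
    Finset.sum_add_distrib, Finset.sum_ite_eq', Finset.mem_univ, sub_eq_zero, eq_comm (a := j)]
  split_ifs <;> ring

lemma ae_A_sq_le [IsProbabilityMeasure P] [NeZero d] (h : IsElephantWalk P d p μ η A β X Y) {n : ℕ} (hn : 1 ≤ n)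
    (i j : Fin d) : ∀ᵐ ω ∂P, A (n + 1) ω i j ^ 2 ≤ 1 := by
  filter_upwards [h.ae_A hn] with ω ⟨x, hx⟩
  rw [hx, signedShift_apply_sq]
  split_ifs <;> norm_num

lemma ae_β [IsProbabilityMeasure P] (h : IsElephantWalk P d p μ η A β X Y) {n : ℕ} (hn : 1 ≤ n) :
    ∀ᵐ ω ∂P, β n ω ∈ Finset.Icc 1 n := by
  have hn' : (n : ℝ) ≠ 0 := by positivity
  have hs : ∑ k ∈ Finset.Icc 1 n, P.real {ω | β n ω = id k} = 1 := by
    simp only [id]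
    rw [Finset.sum_congr rfl (h.law_β n hn)]
    simp [hn']
  filter_upwards [ae_mem_range_of_sum_eq_one (h.measurable_β n hn) _
    Function.injective_id.injOn hs] with ω ⟨k, hk, e⟩
  rwa [e]

lemma ae_isAxisVector_one [IsProbabilityMeasure P] [NeZero d] (h : IsElephantWalk P d p μ η A β X Y) :
    ∀ᵐ ω ∂P, IsAxisVector (X 1 ω) := by
  have hd : (d : ℝ) ≠ 0 := Nat.cast_ne_zero.2 (NeZero.ne d)
  let V : Fin d × Bool → Fin d → ℝ := fun x =>
    (if x.2 then (1 : ℝ) else -1) • (Pi.single x.1 1 : Fin d → ℝ)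
  have hV : Function.Injective V := by
    rintro ⟨k, s⟩ ⟨l, t⟩ e
    have h1 := congrFun e k
    by_cases hkl : k = l
    · subst hkl
      cases s <;> cases t <;> first | rfl | norm_num [V] at h1
    · cases s <;> cases t <;> simp [V, hkl] at h1
  have hs : ∑ x : Fin d × Bool, P.real {ω | X 1 ω = V x} = 1 := by
    simp only [V, Fintype.sum_prod_type, Fintype.sum_bool, if_true, Bool.false_eq_true, if_false,
      one_smul, neg_smul, h.first_pos, h.first_neg, Finset.sum_const, Finset.card_univ,
      Fintype.card_fin, nsmul_eq_mul]
    field_simp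
    norm_num
  filter_upwards [ae_mem_range_of_sum_eq_one (h.measurable_X 1 le_rfl) Finset.univ
    hV.injOn hs] with ω ⟨x, _, e⟩
  rw [e]
  exact isAxisVector_single _ (by split_ifs <;> norm_num)

lemma ae_isAxisVector [IsProbabilityMeasure P] [NeZero d] (h : IsElephantWalk P d p μ η A β X Y) :
    ∀ᵐ ω ∂P, ∀ n, 1 ≤ n → IsAxisVector (X n ω) := by
  have hA : ∀ᵐ ω ∂P, ∀ n, 1 ≤ n → ∃ x : Fin d × Bool, A (n + 1) ω = signedShift x := by
    exact ae_all_iff.2 fun n => eventually_imp_distrib_left.2 fun hn => h.ae_A hn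
  have hβ : ∀ᵐ ω ∂P, ∀ n, 1 ≤ n → β n ω ∈ Finset.Icc 1 n := by
    exact ae_all_iff.2 fun n => eventually_imp_distrib_left.2 fun hn => h.ae_β hn
  have hr : ∀ᵐ ω ∂P, ∀ n, 1 ≤ n → X (n + 1) ω = A (n + 1) ω *ᵥ X (β n ω) ω := by
    exact ae_all_iff.2 fun n => eventually_imp_distrib_left.2 fun hn => h.recursion n hn
  filter_upwards [hA, hβ, hr, h.ae_isAxisVector_one] with ω h1 h2 h3 h4 n
  -- Strong induction, because `β` may select any earlier time.
  induction n using Nat.strong_induction_on with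
  | _ n ih =>
    intro hn
    obtain rfl | ⟨m, hm, rfl⟩ : n = 1 ∨ ∃ m, 1 ≤ m ∧ n = m + 1 := by
      rcases Nat.lt_or_ge 1 n with h | h
      · exact Or.inr ⟨n - 1, by omega, by omega⟩
      · exact Or.inl (by omega)
    · exact h4
    · obtain ⟨x, hx⟩ := h1 m hm
      have hb := Finset.mem_Icc.1 (h2 m hm)
      rw [h3 m hm, hx]
      exact (ih _ (by omega) hb.1).signedShift_mulVec x

lemma pastSigma_le (h : IsElephantWalk P d p μ η A β X Y) (n : ℕ) :
    pastSigma X Y n ≤ ‹MeasurableSpace Ω› :=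
  iSup₂_le fun k hk => sup_le (h.measurable_X k (Finset.mem_Icc.1 hk).1).comap_le
    (h.measurable_Y k (Finset.mem_Icc.1 hk).1).comap_le

/-- The filtration `n ↦ σ(X₁, …, X_{n+1}, Y₁, …, Y_{n+1})`. -/
def past (h : IsElephantWalk P d p μ η A β X Y) : Filtration ℕ ‹MeasurableSpace Ω› where
  seq n := pastSigma X Y (n + 1)
  mono' _ _ hmn := iSup₂_le fun k hk => le_iSup₂_of_le (f := fun k _ =>
    MeasurableSpace.comap (X k) inferInstance ⊔ MeasurableSpace.comap (Y k) inferInstance) k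
    (Finset.Icc_subset_Icc_right (Nat.succ_le_succ hmn) hk) le_rfl
  le' n := h.pastSigma_le (n + 1)

end IsElephantWalk

lemma measurable_mulVec {Ω : Type*} {m : MeasurableSpace Ω} {d : ℕ}
    {M : Ω → Matrix (Fin d) (Fin d) ℝ} {x : Ω → Fin d → ℝ} (hM : Measurable M)
    (hx : Measurable x) : Measurable fun ω => M ω *ᵥ x ω := by
  refine measurable_pi_lambda _ fun i => ?_
  simp only [Matrix.mulVec, dotProduct]
  exact Finset.measurable_fun_sum _ fun j _ => ((measurable_matrix_entry i j).comp hM).mul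
    ((measurable_pi_apply j).comp hx)

/-! ### Independence and conditional moments of the next step -/

namespace IsElephantWalk

variable {Ω : Type*} [MeasurableSpace Ω] {P : Measure Ω} {d : ℕ}
  {p μ η : ℝ} {A : ℕ → Ω → Matrix (Fin d) (Fin d) ℝ} {β : ℕ → Ω → ℕ}
  {X : ℕ → Ω → Fin d → ℝ} {Y : ℕ → Ω → ℝ}

lemma indep_sigma (h : IsElephantWalk P d p μ η A β X Y) {n : ℕ} (hn : 1 ≤ n)
    {S T : Set (Fin 4)} (hST : Disjoint S T) :
    Indep (⨆ i ∈ S, (![MeasurableSpace.comap (A (n + 1)) inferInstance,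
        MeasurableSpace.comap (β n) inferInstance, MeasurableSpace.comap (Y (n + 1)) inferInstance,
        pastSigma X Y n] : Fin 4 → MeasurableSpace Ω) i)
      (⨆ i ∈ T, (![MeasurableSpace.comap (A (n + 1)) inferInstance,
        MeasurableSpace.comap (β n) inferInstance, MeasurableSpace.comap (Y (n + 1)) inferInstance,
        pastSigma X Y n] : Fin 4 → MeasurableSpace Ω) i) P := by
  refine indep_iSup_of_disjoint (fun i => ?_) (h.indep n hn) hST
  fin_cases i
  · exact (h.measurable_A n hn).comap_le
  · exact (h.measurable_β n hn).comap_le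
  · exact (h.measurable_Y (n + 1) (by omega)).comap_le
  · exact h.pastSigma_le n

lemma indep_size (h : IsElephantWalk P d p μ η A β X Y) {n : ℕ} (hn : 1 ≤ n) :
    Indep (MeasurableSpace.comap (A (n + 1)) inferInstance ⊔
        MeasurableSpace.comap (β n) inferInstance ⊔ pastSigma X Y n)
      (MeasurableSpace.comap (Y (n + 1)) inferInstance) P := by
  have := h.indep_sigma hn (S := {0, 1, 3}) (T := {2}) (by simp)
  refine indep_of_indep_of_le_left (indep_of_indep_of_le_right this ?_) ?_
  · exact le_iSup₂_of_le 2 rfl le_rfl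
  · exact sup_le (sup_le (le_iSup₂_of_le 0 (by simp) le_rfl) (le_iSup₂_of_le 1 (by simp) le_rfl))
      (le_iSup₂_of_le 3 (by simp) le_rfl)

lemma indep_past (h : IsElephantWalk P d p μ η A β X Y) {n : ℕ} (hn : 1 ≤ n) :
    Indep (MeasurableSpace.comap (A (n + 1)) inferInstance ⊔
        MeasurableSpace.comap (β n) inferInstance) (pastSigma X Y n) P := by
  have := h.indep_sigma hn (S := {0, 1}) (T := {3}) (by simp)
  refine indep_of_indep_of_le_left (indep_of_indep_of_le_right this ?_) ?_
  · exact le_iSup₂_of_le 3 rfl le_rfl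
  · exact sup_le (le_iSup₂_of_le 0 (by simp) le_rfl) (le_iSup₂_of_le 1 (by simp) le_rfl)

/-- Resolving the random index into a finite sum exhibits the next direction as a function of the
new choices and the past, so that its joint independence from the new size can be used. -/
lemma ae_step_eq_sum [IsProbabilityMeasure P] (h : IsElephantWalk P d p μ η A β X Y) {n : ℕ}
    (hn : 1 ≤ n) : X (n + 1) =ᵐ[P] fun ω => ∑ k ∈ Finset.Icc 1 n,
      if β n ω = k then A (n + 1) ω *ᵥ X k ω else 0 := by
  filter_upwards [h.recursion n hn, h.ae_β hn] with ω h1 h2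
  rw [h1, Finset.sum_ite_eq, if_pos h2]

/-- The `σ`-algebra generated by the past and by the choices that determine the next direction. -/
abbrev stepSigma (A : ℕ → Ω → Matrix (Fin d) (Fin d) ℝ) (β : ℕ → Ω → ℕ)
    (X : ℕ → Ω → Fin d → ℝ) (Y : ℕ → Ω → ℝ) (n : ℕ) : MeasurableSpace Ω :=
  MeasurableSpace.comap (A (n + 1)) inferInstance ⊔
    MeasurableSpace.comap (β n) inferInstance ⊔ pastSigma X Y n

/-- A function of the past and of the next direction is independent of the next size. -/
lemma indepFun_step_size [IsProbabilityMeasure P] (h : IsElephantWalk P d p μ η A β X Y) {n : ℕ}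
    (hn : 1 ≤ n) {f : Ω → ℝ} (hf : Measurable[pastSigma X Y n] f) {φ : (Fin d → ℝ) → ℝ}
    (hφ : Measurable φ) {ψ : ℝ → ℝ} (hψ : Measurable ψ) :
    IndepFun (fun ω => f ω * φ (X (n + 1) ω)) (fun ω => ψ (Y (n + 1) ω)) P := by
  have hA : Measurable[stepSigma A β X Y n] (A (n + 1)) :=
    (comap_measurable (A (n + 1))).mono (le_sup_left.trans le_sup_left) le_rfl
  have hβ : Measurable[stepSigma A β X Y n] (β n) :=
    (comap_measurable (β n)).mono (le_sup_right.trans le_sup_left) le_rfl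
  have hg : Measurable[stepSigma A β X Y n] (fun ω => ∑ k ∈ Finset.Icc 1 n,
      if β n ω = k then A (n + 1) ω *ᵥ X k ω else 0) := by
    refine Finset.measurable_fun_sum _ fun k hk => ?_
    refine Measurable.ite (hβ (measurableSet_singleton k)) ?_ measurable_const
    exact measurable_mulVec hA ((measurable_step_pastSigma hk).mono le_sup_right le_rfl)
  have hF := (hf.mono (le_sup_right : _ ≤ stepSigma A β X Y n) le_rfl).mul (hφ.comp hg)
  have hind : IndepFun (fun ω => f ω * φ (∑ k ∈ Finset.Icc 1 n,
      if β n ω = k then A (n + 1) ω *ᵥ X k ω else 0)) (fun ω => ψ (Y (n + 1) ω)) P := by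
    rw [IndepFun_iff_Indep]
    exact indep_of_indep_of_le_left (indep_of_indep_of_le_right (h.indep_size hn)
      (hψ.comp (comap_measurable (Y (n + 1)))).comap_le) hF.comap_le
  refine hind.congr ?_ (ae_eq_refl _)
  filter_upwards [h.ae_step_eq_sum hn] with ω hω
  rw [hω]

lemma integral_step_size [IsProbabilityMeasure P] (h : IsElephantWalk P d p μ η A β X Y) {n : ℕ}
    (hn : 1 ≤ n) {f : Ω → ℝ} (hf : Measurable[pastSigma X Y n] f) {φ : (Fin d → ℝ) → ℝ}
    (hφ : Measurable φ) {ψ : ℝ → ℝ} (hψ : Measurable ψ) :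
    ∫ ω, f ω * φ (X (n + 1) ω) * ψ (Y (n + 1) ω) ∂P
      = (∫ ω, f ω * φ (X (n + 1) ω) ∂P) * ∫ ω, ψ (Y (n + 1) ω) ∂P := by
  refine (h.indepFun_step_size hn hf hφ hψ).integral_mul_eq_mul_integral ?_ ?_
  · exact ((hf.mono (h.pastSigma_le n) le_rfl).mul
      (hφ.comp (h.measurable_X (n + 1) (by omega)))).aestronglyMeasurable
  · exact (hψ.comp (h.measurable_Y (n + 1) (by omega))).aestronglyMeasurable

lemma setIntegral_step_size [IsProbabilityMeasure P] (h : IsElephantWalk P d p μ η A β X Y)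
    {n : ℕ} (hn : 1 ≤ n) {f : Ω → ℝ} (hf : Measurable[pastSigma X Y n] f) {φ : (Fin d → ℝ) → ℝ}
    (hφ : Measurable φ) {ψ : ℝ → ℝ} (hψ : Measurable ψ) (hψ0 : ∫ ω, ψ (Y (n + 1) ω) ∂P = 0)
    {s : Set Ω} (hs : MeasurableSet[pastSigma X Y n] s) :
    ∫ ω in s, f ω * φ (X (n + 1) ω) * ψ (Y (n + 1) ω) ∂P = 0 := by
  rw [← integral_indicator (h.pastSigma_le n s hs)]
  -- The indicator of a past event is absorbed into the factor measurable with respect to the past.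
  have e : s.indicator (fun ω => f ω * φ (X (n + 1) ω) * ψ (Y (n + 1) ω))
      = fun ω => s.indicator f ω * φ (X (n + 1) ω) * ψ (Y (n + 1) ω) := by
    ext ω
    by_cases hω : ω ∈ s <;> simp [hω]
  rw [e, h.integral_step_size hn (hf.indicator hs) hφ hψ, hψ0, mul_zero]

/-- Independence factors the second moment, and the direction factor is at most one in absolute
value since directions are axis vectors. -/
lemma memLp_step_size [IsProbabilityMeasure P] [NeZero d]
    (h : IsElephantWalk P d p μ η A β X Y) {n : ℕ} (hn : 1 ≤ n) {f : Ω → ℝ}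
    (hf : Measurable[pastSigma X Y n] f) (hf2 : MemLp f 2 P) {φ : (Fin d → ℝ) → ℝ}
    (hφ : Measurable φ) (hφ1 : ∀ x, IsAxisVector x → |φ x| ≤ 1) {ψ : ℝ → ℝ} (hψ : Measurable ψ)
    (hψ2 : MemLp (fun ω => ψ (Y (n + 1) ω)) 2 P) :
    MemLp (fun ω => f ω * φ (X (n + 1) ω) * ψ (Y (n + 1) ω)) 2 P ∧
      ∫ ω, (f ω * φ (X (n + 1) ω) * ψ (Y (n + 1) ω)) ^ 2 ∂P
        ≤ (∫ ω, f ω ^ 2 ∂P) * ∫ ω, ψ (Y (n + 1) ω) ^ 2 ∂P := by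
  have hfm := hf.mono (h.pastSigma_le n) le_rfl
  have hXm := hφ.comp (h.measurable_X (n + 1) (by omega))
  have hφle : ∀ᵐ ω ∂P, |φ (X (n + 1) ω)| ≤ 1 := by
    filter_upwards [h.ae_isAxisVector] with ω hω
    exact hφ1 _ (hω _ (by omega))
  have hfφ : MemLp (fun ω => f ω * φ (X (n + 1) ω)) 2 P := by
    refine hf2.mono (hfm.mul hXm).aestronglyMeasurable ?_
    filter_upwards [hφle] with ω hω
    rw [norm_mul]
    exact mul_le_of_le_one_right (norm_nonneg _) hω
  have hind := h.indepFun_step_size hn hf hφ hψ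
  have hind2 : IndepFun (fun ω => (f ω * φ (X (n + 1) ω)) ^ 2) (fun ω => ψ (Y (n + 1) ω) ^ 2) P :=
    hind.comp (measurable_id.pow_const 2) (measurable_id.pow_const 2)
  have hint := hind2.integrable_mul hfφ.integrable_sq hψ2.integrable_sq
  constructor
  · refine (memLp_two_iff_integrable_sq
      (hfφ.aestronglyMeasurable.mul hψ2.aestronglyMeasurable)).2 ?_
    simpa only [mul_pow, Pi.mul_def] using hint
  · have e := hind2.integral_mul_eq_mul_integral hfφ.integrable_sq.aestronglyMeasurable
      hψ2.integrable_sq.aestronglyMeasurable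
    simp only [Pi.mul_apply] at e
    simp only [mul_pow _ (ψ _)]
    rw [e]
    refine mul_le_mul_of_nonneg_right ?_ (integral_nonneg fun ω => sq_nonneg _)
    refine integral_mono_ae hfφ.integrable_sq hf2.integrable_sq ?_
    filter_upwards [hφle] with ω hω
    simp only [mul_pow]
    exact mul_le_of_le_one_right (sq_nonneg _) ((sq_le_one_iff_abs_le_one _).2 hω)

lemma integrable_step_sq [IsProbabilityMeasure P] [NeZero d]
    (h : IsElephantWalk P d p μ η A β X Y) {n : ℕ} (hn : 1 ≤ n) (i : Fin d) :
    Integrable (fun ω => X n ω i ^ 2) P := by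
  refine Integrable.of_bound (C := 1)
    (((measurable_pi_apply i).comp (h.measurable_X n hn)).pow_const 2).aestronglyMeasurable ?_
  filter_upwards [h.ae_isAxisVector] with ω hω
  rw [Real.norm_of_nonneg (sq_nonneg _)]
  exact (hω n hn).sq_le_one i

lemma integral_choice_mul [IsProbabilityMeasure P] [NeZero d]
    (h : IsElephantWalk P d p μ η A β X Y) {n : ℕ} (hn : 1 ≤ n) {k : ℕ}
    (hk : k ∈ Finset.Icc 1 n) (i j : Fin d) {f : Ω → ℝ} (hf : Measurable[pastSigma X Y n] f)
    (hfi : Integrable f P) :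
    Integrable (fun ω => (if β n ω = k then 1 else 0) * A (n + 1) ω i j ^ 2 * f ω) P ∧
    ∫ ω, (if β n ω = k then 1 else 0) * A (n + 1) ω i j ^ 2 * f ω ∂P
      = 1 / n * (∫ ω, A (n + 1) ω i j ^ 2 ∂P) * ∫ ω, f ω ∂P := by
  have hAm : Measurable fun ω => A (n + 1) ω i j ^ 2 :=
    ((measurable_matrix_entry i j).comp (h.measurable_A n hn)).pow_const 2
  have hβs : MeasurableSet {ω | β n ω = k} := h.measurable_β n hn (measurableSet_singleton k)
  have hβm : Measurable fun ω => if β n ω = k then (1 : ℝ) else 0 :=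
    Measurable.ite hβs measurable_const measurable_const
  have hβi : ∫ ω, (if β n ω = k then (1 : ℝ) else 0) ∂P = 1 / n := by
    rw [← h.law_β n hn k hk, ← integral_indicator_one hβs]
    simp only [Set.indicator, Set.mem_ofPred_eq, Pi.one_apply]
  have hAβ : IndepFun (fun ω => if β n ω = k then (1 : ℝ) else 0)
      (fun ω => A (n + 1) ω i j ^ 2) P := by
    have hi : IndepFun (β n) (A (n + 1)) P := by
      rw [IndepFun_iff_Indep]
      exact (h.indep n hn).indep (i := 1) (j := 0) (by decide)
    exact hi.comp (φ := fun m : ℕ => if m = k then (1 : ℝ) else 0) (ψ := fun M => M i j ^ 2)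
      (measurable_of_countable _) ((measurable_matrix_entry i j).pow_const 2)
  have hAi : Integrable (fun ω => A (n + 1) ω i j ^ 2) P := by
    refine Integrable.of_bound (C := 1) hAm.aestronglyMeasurable ?_
    filter_upwards [h.ae_A_sq_le hn i j] with ω hω
    rwa [Real.norm_of_nonneg (sq_nonneg _)]
  have hβint : Integrable (fun ω => if β n ω = k then (1 : ℝ) else 0) P :=
    Integrable.of_bound (C := 1) hβm.aestronglyMeasurable
      (Eventually.of_forall fun ω => by split_ifs <;> simp)
  have hpast : IndepFun (fun ω => (if β n ω = k then (1 : ℝ) else 0) * A (n + 1) ω i j ^ 2) f P := by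
    rw [IndepFun_iff_Indep]
    refine indep_of_indep_of_le_left (indep_of_indep_of_le_right (h.indep_past hn) hf.comap_le) ?_
    refine Measurable.comap_le (Measurable.mul ?_ ?_)
    · exact ((measurable_of_countable fun m : ℕ => if m = k then (1 : ℝ) else 0).comp
        (comap_measurable (β n))).mono le_sup_right le_rfl
    · exact (((measurable_matrix_entry i j).pow_const 2).comp
        (comap_measurable (A (n + 1)))).mono le_sup_left le_rfl
  refine ⟨hpast.integrable_mul (hAβ.integrable_mul hβint hAi) hfi, ?_⟩
  have e1 := hpast.integral_mul_eq_mul_integral (hβm.mul hAm).aestronglyMeasurable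
    hfi.aestronglyMeasurable
  have e2 := hAβ.integral_mul_eq_mul_integral hβm.aestronglyMeasurable hAm.aestronglyMeasurable
  simp only [Pi.mul_apply] at e1 e2
  rw [e1, e2, hβi]

/-- The conditional law of the axis of the next step. -/
lemma setIntegral_step_sq [IsProbabilityMeasure P] [NeZero d]
    (h : IsElephantWalk P d p μ η A β X Y) {n : ℕ} (hn : 1 ≤ n) (i : Fin d) {s : Set Ω}
    (hs : MeasurableSet[pastSigma X Y n] s) :
    ∫ ω in s, X (n + 1) ω i ^ 2 ∂P = ∫ ω in s, (2 * ((1 - p) / (2 * (d : ℝ) - 1))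
      + (p - (1 - p) / (2 * (d : ℝ) - 1)) * ((∑ k ∈ Finset.Icc 1 n, X k ω i ^ 2) / n)) ∂P := by
  have hsm := h.pastSigma_le n s hs
  have hn' : (n : ℝ) ≠ 0 := by positivity
  set r := (1 - p) / (2 * (d : ℝ) - 1) with hr
  have hf : ∀ k ∈ Finset.Icc 1 n, ∀ j : Fin d,
      Measurable[pastSigma X Y n] (s.indicator fun ω => X k ω j ^ 2) := fun k hk j =>
    (((measurable_pi_apply j).comp (measurable_step_pastSigma hk)).pow_const 2).indicator hs
  have hfi : ∀ k ∈ Finset.Icc 1 n, ∀ j : Fin d,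
      Integrable (s.indicator fun ω => X k ω j ^ 2) P := fun k hk j =>
    (h.integrable_step_sq (Finset.mem_Icc.1 hk).1 j).indicator hsm
  have e1 : s.indicator (fun ω => X (n + 1) ω i ^ 2) =ᵐ[P] fun ω => ∑ k ∈ Finset.Icc 1 n, ∑ j,
      (if β n ω = k then 1 else 0) * A (n + 1) ω i j ^ 2
        * s.indicator (fun ω => X k ω j ^ 2) ω := by
    filter_upwards [h.recursion n hn, h.ae_β hn, h.ae_isAxisVector] with ω h1 h2 h3
    have e : ∀ k ∈ Finset.Icc 1 n, ∑ j, (if β n ω = k then 1 else 0) * A (n + 1) ω i j ^ 2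
        * s.indicator (fun ω => X k ω j ^ 2) ω
        = if β n ω = k then s.indicator (fun ω => (A (n + 1) ω *ᵥ X k ω) i ^ 2) ω else 0 := by
      intro k hk
      split_ifs
      · by_cases hω : ω ∈ s
        · simp only [Set.indicator_of_mem hω, (h3 k (Finset.mem_Icc.1 hk).1).mulVec_sq, one_mul]
        · simp [hω]
      · simp
    rw [Finset.sum_congr rfl e, Finset.sum_ite_eq, if_pos h2]
    by_cases hω : ω ∈ s
    · simp only [Set.indicator_of_mem hω, h1]
    · simp [hω]
  -- The squared coordinates of an axis vector sum to one, so the constant 2r can be distributed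
  -- over the coordinates `j` to match `e1` term by term.
  have e2 : s.indicator (fun ω => 2 * r + (p - r) * ((∑ k ∈ Finset.Icc 1 n, X k ω i ^ 2) / n))
      =ᵐ[P] fun ω => ∑ k ∈ Finset.Icc 1 n, ∑ j,
      (1 / n * (2 * r + if i = j then p - r else 0)) * s.indicator (fun ω => X k ω j ^ 2) ω := by
    filter_upwards [h.ae_isAxisVector] with ω h3
    by_cases hω : ω ∈ s
    · simp only [Set.indicator_of_mem hω]
      have e : ∀ k ∈ Finset.Icc 1 n,
          ∑ j, (1 / (n : ℝ) * (2 * r + if i = j then p - r else 0)) * X k ω j ^ 2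
          = 1 / n * (2 * r) + 1 / n * (p - r) * X k ω i ^ 2 := by
        intro k hk
        simp only [mul_add, add_mul, Finset.sum_add_distrib, ← Finset.mul_sum,
          (h3 k (Finset.mem_Icc.1 hk).1).1, mul_ite, ite_mul, mul_zero, zero_mul,
          Finset.sum_ite_eq, Finset.mem_univ, if_true, mul_one]
      rw [Finset.sum_congr rfl e, Finset.sum_add_distrib, Finset.sum_const, ← Finset.mul_sum]
      simp only [Nat.card_Icc, add_tsub_cancel_right, nsmul_eq_mul]
      field_simp
    · simp [hω]
  rw [← integral_indicator hsm, ← integral_indicator hsm, integral_congr_ae e1,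
    integral_congr_ae e2, integral_finsetSum, integral_finsetSum]
  · refine Finset.sum_congr rfl fun k hk => ?_
    rw [integral_finsetSum, integral_finsetSum]
    · refine Finset.sum_congr rfl fun j _ => ?_
      rw [(h.integral_choice_mul hn hk i j (hf k hk j) (hfi k hk j)).2, h.integral_A_sq hn,
        integral_const_mul]
    · exact fun j _ => (hfi k hk j).const_mul _
    · exact fun j _ => (h.integral_choice_mul hn hk i j (hf k hk j) (hfi k hk j)).1
  · exact fun k hk => integrable_finsetSum _ fun j _ => (hfi k hk j).const_mul _
  · exact fun k hk => integrable_finsetSum _ fun j _ =>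
      (h.integral_choice_mul hn hk i j (hf k hk j) (hfi k hk j)).1

end IsElephantWalk

/-! ### Truncation estimates -/

lemma sum_Icc_one_eq_sum_range {M : Type*} [AddCommMonoid M] (f : ℕ → M) (n : ℕ) :
    ∑ k ∈ Finset.Icc 1 n, f k = ∑ k ∈ Finset.range n, f (k + 1) := by
  induction n with
  | zero => simp
  | succ n ih => rw [Finset.sum_Icc_succ_top (by omega), ih, Finset.sum_range_succ]

lemma summable_inv_mul_sqrt :
    Summable fun k : ℕ => 1 / (((k : ℝ) + 2) * √((k : ℝ) + 2)) := by
  have h : Summable fun k : ℕ => 1 / ((k : ℝ) ^ (3 / 2 : ℝ)) :=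
    Real.summable_one_div_nat_rpow.2 (by norm_num)
  refine ((summable_nat_add_iff 2).2 h).congr fun k => ?_
  have hk : (0 : ℝ) < (k : ℝ) + 2 := by positivity
  push_cast
  rw [Real.sqrt_eq_rpow, show (3 / 2 : ℝ) = 1 + 1 / 2 by norm_num, Real.rpow_add hk, Real.rpow_one]

/-- Interpolation between fourth and third powers: truncation at `t` costs a factor √t. It bounds
the variance of the truncated squares by the third moment. -/
lemma min_sq_sq_le (x : ℝ) {t : ℝ} (ht : 0 ≤ t) : min (x ^ 2) t ^ 2 ≤ √t * |x| ^ 3 := by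
  obtain ⟨s, hs, rfl⟩ : ∃ s, 0 ≤ s ∧ t = s ^ 2 := ⟨√t, Real.sqrt_nonneg t, (Real.sq_sqrt ht).symm⟩
  rw [Real.sqrt_sq hs, ← sq_abs x]
  have ha := abs_nonneg x
  generalize |x| = a at *
  rcases le_total a s with h | h
  · rw [min_eq_left (by gcongr)]
    nlinarith [mul_le_mul_of_nonneg_right h (pow_nonneg ha 3)]
  · rw [min_eq_right (by gcongr)]
    have := mul_le_mul_of_nonneg_left (pow_le_pow_left₀ hs h 3) hs
    nlinarith

/-- The overflow vanishes unless |x| > √t, and there x² ≤ |x|³/√t. -/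
lemma sq_sub_min_le (x : ℝ) {t : ℝ} (ht : 0 < t) : x ^ 2 - min (x ^ 2) t ≤ |x| ^ 3 / √t := by
  obtain ⟨s, hs, rfl⟩ : ∃ s, 0 < s ∧ t = s ^ 2 :=
    ⟨√t, Real.sqrt_pos.2 ht, (Real.sq_sqrt ht.le).symm⟩
  rw [Real.sqrt_sq hs.le, ← sq_abs x, le_div_iff₀ hs]
  have ha := abs_nonneg x
  generalize |x| = a at *
  rcases le_total a s with h | h
  · rw [min_eq_left (by gcongr), sub_self, zero_mul]
    positivity
  · rw [min_eq_right (by gcongr)]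
    nlinarith [mul_le_mul_of_nonneg_left h (sq_nonneg a), pow_nonneg hs.le 3]

/-! ### Quadratic terms: axis frequencies and squared sizes -/

namespace IsElephantWalk

variable {Ω : Type*} [MeasurableSpace Ω] {P : Measure Ω} {d : ℕ}
  {p μ η : ℝ} {A : ℕ → Ω → Matrix (Fin d) (Fin d) ℝ} {β : ℕ → Ω → ℕ}
  {X : ℕ → Ω → Fin d → ℝ} {Y : ℕ → Ω → ℝ}

/-- The differences between X_{k+2,i}² and its conditional mean, divided by k+2, are bounded
martingale increments of size O(1/k), so their sum converges. The fixed point of the conditional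
mean is 1/d. -/
lemma ae_tendsto_axis_frequency [IsProbabilityMeasure P] [NeZero d]
    (h : IsElephantWalk P d p μ η A β X Y)
    (hp : 2 ≤ d → p < 1) (i : Fin d) :
    ∀ᵐ ω ∂P, Tendsto (fun n => (∑ k ∈ Finset.range n, X (k + 1) ω i ^ 2 / ((k : ℝ) + 1))
      / harmonicSum n) atTop (𝓝 (1 / d)) := by
  -- Dimension one is separate because p = 1 is allowed there: the slope p − r would be 1 and the
  -- fixed point undetermined. But the only squared coordinate is then constantly 1.
  rcases Nat.lt_or_ge d 2 with hd | hd
  · obtain rfl : d = 1 := by have := NeZero.ne d; omega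
    filter_upwards [h.ae_isAxisVector] with ω hω
    have e : ∀ k, X (k + 1) ω i ^ 2 = 1 := fun k => by
      have := (hω (k + 1) (by omega)).1
      rwa [Fin.sum_univ_one, Subsingleton.elim 0 i] at this
    simp only [e]
    rw [Nat.cast_one, div_one]
    refine tendsto_const_nhds.congr' ?_
    filter_upwards [tendsto_harmonicSum.eventually_gt_atTop 0] with n hn
    exact (div_self hn.ne').symm
  have hp' := hp hd
  have hd' : (2 : ℝ) ≤ d := by exact_mod_cast hd
  set r := (1 - p) / (2 * (d : ℝ) - 1) with hr
  have hr0 : 0 < r := div_pos (by linarith) (by linarith)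
  have hrd : (2 * (d : ℝ) - 1) * r = 1 - p := mul_div_cancel₀ _ (by linarith)
  let D : ℕ → Ω → ℝ := fun k ω => (X (k + 2) ω i ^ 2 - 2 * r
    - (p - r) * ((∑ l ∈ Finset.range (k + 1), X (l + 1) ω i ^ 2) / ((k : ℝ) + 1))) / ((k : ℝ) + 2)
  have hX : ∀ m k, k ∈ Finset.Icc 1 m → Measurable[pastSigma X Y m] fun ω => X k ω i ^ 2 :=
    fun m k hk => ((measurable_pi_apply i).comp (measurable_step_pastSigma hk)).pow_const 2
  have hmeas : ∀ k, Measurable[h.past (k + 1)] (D k) := fun k => by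
    refine Measurable.div_const (Measurable.sub (Measurable.sub_const ?_ _)
      (Measurable.const_mul (Measurable.div_const ?_ _) _)) _
    · exact hX _ _ (Finset.mem_Icc.2 (by omega))
    · refine Finset.measurable_fun_sum _ fun l hl => hX _ _ (Finset.mem_Icc.2 ?_)
      have := Finset.mem_range.1 hl
      omega
  have hbd : ∀ k, ∀ᵐ ω ∂P, ‖D k ω‖ ≤ (1 + 2 * r + |p - r|) / ((k : ℝ) + 2) := fun k => by
    filter_upwards [h.ae_isAxisVector] with ω hω
    have hu : ∀ l, X (l + 1) ω i ^ 2 ≤ 1 := fun l => (hω _ (by omega)).sq_le_one i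
    have hs0 : 0 ≤ (∑ l ∈ Finset.range (k + 1), X (l + 1) ω i ^ 2) / ((k : ℝ) + 1) := by positivity
    have hs1 : (∑ l ∈ Finset.range (k + 1), X (l + 1) ω i ^ 2) / ((k : ℝ) + 1) ≤ 1 := by
      rw [div_le_one (by positivity)]
      simpa using Finset.sum_le_card_nsmul (Finset.range (k + 1)) _ 1 fun l _ => hu l
    have hk : (0 : ℝ) < (k : ℝ) + 2 := by positivity
    simp only [D]
    rw [norm_div, Real.norm_of_nonneg hk.le]
    refine div_le_div_of_nonneg_right ?_ hk.le
    refine (norm_sub_le _ _).trans (add_le_add ((norm_sub_le _ _).trans (add_le_add ?_ ?_)) ?_)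
    · rw [Real.norm_of_nonneg (sq_nonneg _)]; exact hu (k + 1)
    · rw [Real.norm_of_nonneg (by positivity)]
    · rw [norm_mul, Real.norm_eq_abs, Real.norm_of_nonneg hs0]
      exact mul_le_of_le_one_right (abs_nonneg _) hs1
  have hDL2 : ∀ k, MemLp (D k) 2 P := fun k =>
    MemLp.of_bound ((hmeas k).mono ((h.past).le _) le_rfl).aestronglyMeasurable _ (hbd k)
  have hint : ∀ k s, MeasurableSet[h.past k] s → ∫ ω in s, D k ω ∂P = 0 := fun k s hs => by
    have hs' : MeasurableSet[pastSigma X Y (k + 1)] s := hs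
    have e := h.setIntegral_step_sq (n := k + 1) (by omega) i hs'
    simp only [sum_Icc_one_eq_sum_range] at e
    have hi : Integrable (fun ω => 2 * r + (p - r) *
        ((∑ l ∈ Finset.range (k + 1), X (l + 1) ω i ^ 2) / ((k + 1 : ℕ) : ℝ))) P :=
      (integrable_const _).add (((integrable_finsetSum _ fun l _ =>
        h.integrable_step_sq (by omega) i).div_const _).const_mul _)
    simp only [D]
    rw [integral_div]
    have e' : ∀ ω, X (k + 2) ω i ^ 2 - 2 * r - (p - r) *
        ((∑ l ∈ Finset.range (k + 1), X (l + 1) ω i ^ 2) / ((k : ℝ) + 1))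
        = X (k + 1 + 1) ω i ^ 2 - (2 * r + (p - r) *
        ((∑ l ∈ Finset.range (k + 1), X (l + 1) ω i ^ 2) / ((k + 1 : ℕ) : ℝ))) := fun ω => by
      push_cast; ring
    simp only [e']
    rw [integral_sub (h.integrable_step_sq (by omega) i).integrableOn hi.integrableOn, e, sub_self,
      zero_div]
  have hsum : Summable fun k => ∫ ω, D k ω ^ 2 ∂P := by
    have hs : Summable fun k : ℕ => (1 + 2 * r + |p - r|) ^ 2 * (1 / ((k + 2 : ℕ) : ℝ) ^ 2) :=
      ((summable_nat_add_iff 2).2 (Real.summable_one_div_nat_pow.2 one_lt_two)).mul_left _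
    refine hs.of_nonneg_of_le (fun k => integral_nonneg fun ω => sq_nonneg _) fun k => ?_
    calc ∫ ω, D k ω ^ 2 ∂P ≤ ∫ ω, ((1 + 2 * r + |p - r|) / ((k : ℝ) + 2)) ^ 2 ∂P := by
          refine integral_mono_ae (hDL2 k).integrable_sq (integrable_const _) ?_
          filter_upwards [hbd k] with ω hω
          simp only [← sq_abs (D k ω)]
          exact pow_le_pow_left₀ (abs_nonneg _) hω 2
      _ = _ := by
          simp only [integral_const, probReal_univ, one_smul]
          push_cast
          rw [div_pow, mul_one_div]
  filter_upwards [ae_exists_tendsto_sum_of_orthogonal h.past hmeas hDL2 hint hsum,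
    h.ae_isAxisVector] with ω ⟨l, hl⟩ hω
  have := tendsto_log_average_of_affine (u := fun k => X (k + 1) ω i ^ 2) (q := 2 * r)
    (a := p - r) (by linarith) (fun k => sq_nonneg _) (fun k => (hω _ (by omega)).sq_le_one i) hl
  -- From (2d − 1)r = 1 − p one gets 1 − (p − r) = 2dr.
  have e : 2 * r / (1 - (p - r)) = 1 / (d : ℝ) := by
    rw [div_eq_div_iff (by linarith) (by linarith)]
    linarith
  rwa [e] at this

lemma memLp_size_sub [IsProbabilityMeasure P]
    (h : IsElephantWalk P d p μ η A β X Y) {n : ℕ} (hn : 1 ≤ n) :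
    MemLp (fun ω => Y n ω - μ) 2 P := by
  refine MemLp.sub ?_ (memLp_const μ)
  obtain rfl | hn : n = 1 ∨ 2 ≤ n := by omega
  · exact h.first_size_memLp
  · exact (h.size_identDistrib n hn).memLp_iff.2 h.size_memLp

lemma integral_size_comp (h : IsElephantWalk P d p μ η A β X Y) {n : ℕ} (hn : 2 ≤ n) {g : ℝ → ℝ}
    (hg : Measurable g) : ∫ ω, g (Y n ω) ∂P = ∫ ω, g (Y 2 ω) ∂P :=
  ((h.size_identDistrib n hn).comp hg).integral_eq

lemma integral_size_sub [IsProbabilityMeasure P]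
    (h : IsElephantWalk P d p μ η A β X Y) {n : ℕ} (hn : 2 ≤ n) :
    ∫ ω, (Y n ω - μ) ∂P = 0 := by
  rw [h.integral_size_comp hn (g := fun y => y - μ) (measurable_id.sub_const μ),
    integral_sub (h.size_memLp.integrable one_le_two) (integrable_const _), h.size_mean]
  simp

lemma integral_size_sub_sq (h : IsElephantWalk P d p μ η A β X Y) {n : ℕ} (hn : 2 ≤ n) :
    ∫ ω, (Y n ω - μ) ^ 2 ∂P = η ^ 2 := by
  rw [h.integral_size_comp hn (g := fun y => (y - μ) ^ 2) ((measurable_id.sub_const μ).pow_const 2),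
    ← h.size_variance, variance_eq_integral h.size_memLp.aestronglyMeasurable.aemeasurable,
    h.size_mean]

/-- No fourth moment is available, so (Y − μ)² is truncated at a level growing linearly in time.
Both the variance of the centred truncated terms and the mean of the overflow are then O(k^{-3/2})
after division by the time. -/
lemma ae_tendsto_weighted_axis_frequency [IsProbabilityMeasure P] [NeZero d]
    (h : IsElephantWalk P d p μ η A β X Y)
    (hp : 2 ≤ d → p < 1) (hthird : Integrable (fun ω => |Y 2 ω - μ| ^ 3) P) (i : Fin d) :
    ∀ᵐ ω ∂P, Tendsto (fun n => (∑ k ∈ Finset.range n,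
      (Y (k + 1) ω - μ) ^ 2 * X (k + 1) ω i ^ 2 / ((k : ℝ) + 1)) / harmonicSum n) atTop
      (𝓝 (η ^ 2 * (1 / d))) := by
  set C := ∫ ω, |Y 2 ω - μ| ^ 3 ∂P with hC
  have hC0 : 0 ≤ C := integral_nonneg fun ω => by positivity
  have hsq : Integrable (fun ω => (Y 2 ω - μ) ^ 2) P :=
    (h.memLp_size_sub (n := 2) (by omega)).integrable_sq
  let c : ℕ → ℝ := fun k => ∫ ω, min ((Y 2 ω - μ) ^ 2) ((k : ℝ) + 1) ∂P
  have hmin : ∀ k : ℕ, Integrable (fun ω => min ((Y 2 ω - μ) ^ 2) ((k : ℝ) + 1)) P := fun k =>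
    hsq.inf (integrable_const _)
  have hc0 : ∀ k, 0 ≤ c k := fun k => integral_nonneg fun ω => by positivity
  have hcη : ∀ k, c k ≤ η ^ 2 := fun k => by
    rw [← h.integral_size_sub_sq le_rfl]
    exact integral_mono (hmin k) hsq fun ω => min_le_left _ _
  have hdiff : ∀ k : ℕ, ∫ ω, ((Y 2 ω - μ) ^ 2 - min ((Y 2 ω - μ) ^ 2) ((k : ℝ) + 1)) ∂P
      ≤ C / √((k : ℝ) + 1) := fun k => by
    rw [hC, ← integral_div]
    exact integral_mono (hsq.sub (hmin k)) (hthird.div_const _) fun ω =>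
      sq_sub_min_le _ (by positivity)
  have hc : Tendsto c atTop (𝓝 (η ^ 2)) := by
    have h0 : Tendsto (fun k : ℕ => η ^ 2 - C / √((k : ℝ) + 1)) atTop (𝓝 (η ^ 2)) := by
      have : Tendsto (fun k : ℕ => C / √((k : ℝ) + 1)) atTop (𝓝 0) :=
        (Real.tendsto_sqrt_atTop.comp
          (tendsto_atTop_add_const_right _ 1 tendsto_natCast_atTop_atTop)).const_div_atTop C
      simpa using this.const_sub (η ^ 2)
    refine tendsto_of_tendsto_of_tendsto_of_le_of_le h0 tendsto_const_nhds (fun k => ?_) hcη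
    have := hdiff k
    rw [integral_sub hsq (hmin k), h.integral_size_sub_sq le_rfl] at this
    change _ ≤ ∫ ω, min ((Y 2 ω - μ) ^ 2) ((k : ℝ) + 1) ∂P
    linarith
  -- Centred truncated square for time k + 2, whose zero-based index is k + 1; hence level k + 2 and
  -- centring `c (k + 1)`. Time 1 is left out because `Y 1` has its own law.
  let ψ : ℕ → ℝ → ℝ := fun k y => min ((y - μ) ^ 2) ((k : ℝ) + 2) - c (k + 1)
  have hψm : ∀ k, Measurable (ψ k) := fun k =>
    (((measurable_id.sub_const μ).pow_const 2).min measurable_const).sub_const _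
  have hk1 : ∀ k : ℕ, ((k + 1 : ℕ) : ℝ) + 1 = (k : ℝ) + 2 := fun k => by push_cast; ring
  have hψ0 : ∀ k, ∫ ω, ψ k (Y (k + 1 + 1) ω) ∂P = 0 := fun k => by
    rw [h.integral_size_comp (by omega) (hψm k)]
    have := hmin (k + 1)
    rw [hk1] at this
    simp only [ψ, c]
    rw [integral_sub this (integrable_const _), integral_const, probReal_univ, one_smul]
    simp only [hk1, sub_self]
  have hψb : ∀ k y, ‖ψ k y‖ ≤ (k : ℝ) + 2 + η ^ 2 := fun k y => by
    have h1 : min ((y - μ) ^ 2) ((k : ℝ) + 2) ≤ (k : ℝ) + 2 := min_le_right _ _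
    have h2 : 0 ≤ min ((y - μ) ^ 2) ((k : ℝ) + 2) := by positivity
    have h3 := hc0 (k + 1)
    have h4 := hcη (k + 1)
    rw [Real.norm_eq_abs, abs_le]
    constructor <;> simp only [ψ] <;> nlinarith
  have hψL2 : ∀ k, MemLp (fun ω => ψ k (Y (k + 1 + 1) ω)) 2 P := fun k =>
    MemLp.of_bound ((hψm k).comp (h.measurable_Y _ (by omega))).aestronglyMeasurable _
      (Eventually.of_forall fun ω => hψb k _)
  have hψsq : ∀ k : ℕ, ∫ ω, ψ k (Y (k + 1 + 1) ω) ^ 2 ∂P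
      ≤ (2 * C + 2 * (η ^ 2) ^ 2) * √((k : ℝ) + 2) := fun k => by
    have hk : (0 : ℝ) ≤ (k : ℝ) + 2 := by positivity
    have hs1 : 1 ≤ √((k : ℝ) + 2) := Real.one_le_sqrt.2 (by linarith [(k.cast_nonneg : (0 : ℝ) ≤ k)])
    have hi : Integrable (fun ω => ψ k (Y 2 ω) ^ 2) P :=
      (MemLp.of_bound (p := 2) ((hψm k).comp (h.measurable_Y 2 (by omega))).aestronglyMeasurable _
        (Eventually.of_forall fun ω => hψb k _)).integrable_sq
    rw [h.integral_size_comp (by omega) (g := fun y => ψ k y ^ 2) ((hψm k).pow_const 2)]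
    calc ∫ ω, ψ k (Y 2 ω) ^ 2 ∂P
        ≤ ∫ ω, (2 * √((k : ℝ) + 2) * |Y 2 ω - μ| ^ 3 + 2 * (η ^ 2) ^ 2) ∂P := by
          refine integral_mono hi ((hthird.const_mul _).add (integrable_const _)) fun ω => ?_
          have h1 := min_sq_sq_le (Y 2 ω - μ) hk
          have h2 := pow_le_pow_left₀ (hc0 (k + 1)) (hcη (k + 1)) 2
          simp only [ψ]
          nlinarith [sq_nonneg (min ((Y 2 ω - μ) ^ 2) ((k : ℝ) + 2) + c (k + 1))]
      _ = 2 * √((k : ℝ) + 2) * C + 2 * (η ^ 2) ^ 2 := by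
          rw [integral_add (hthird.const_mul _) (integrable_const _), integral_const_mul]
          simp [hC]
      _ ≤ _ := by nlinarith [sq_nonneg (η ^ 2)]
  let D : ℕ → Ω → ℝ := fun k ω => 1 / ((k : ℝ) + 2) * X (k + 1 + 1) ω i ^ 2 * ψ k (Y (k + 1 + 1) ω)
  have hφ : Measurable fun x : Fin d → ℝ => x i ^ 2 := (measurable_pi_apply i).pow_const 2
  have hDL2 := fun k => h.memLp_step_size (n := k + 1) (by omega)
    (f := fun _ => 1 / ((k : ℝ) + 2)) measurable_const (memLp_const _) hφ
    (fun x hx => by rw [abs_of_nonneg (sq_nonneg _)]; exact hx.sq_le_one i) (hψm k) (hψL2 k)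
  have hsum : Summable fun k => ∫ ω, D k ω ^ 2 ∂P := by
    refine (summable_inv_mul_sqrt.mul_left (2 * C + 2 * (η ^ 2) ^ 2)).of_nonneg_of_le
      (fun k => integral_nonneg fun ω => sq_nonneg _) fun k => (hDL2 k).2.trans ?_
    have hk : (0 : ℝ) < (k : ℝ) + 2 := by positivity
    rw [integral_const, probReal_univ, one_smul]
    refine (mul_le_mul_of_nonneg_left (hψsq k) (by positivity)).trans_eq ?_
    have hs : √((k : ℝ) + 2) ≠ 0 := (Real.sqrt_pos.2 hk).ne'
    have hss := Real.sq_sqrt hk.le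
    field_simp
    rw [hss, mul_comm]
  have hmart := ae_exists_tendsto_sum_of_orthogonal h.past (D := D) (fun k => ?_)
    (fun k => (hDL2 k).1) (fun k s hs => ?_) hsum
  rotate_left
  · have hmem : k + 1 + 1 ∈ Finset.Icc 1 (k + 1 + 1) := Finset.mem_Icc.2 (by omega)
    exact (measurable_const.mul (hφ.comp (measurable_step_pastSigma hmem))).mul
      ((hψm k).comp (measurable_size_pastSigma hmem))
  · exact h.setIntegral_step_size (n := k + 1) (by omega) (f := fun _ => 1 / ((k : ℝ) + 2))
      measurable_const hφ (hψm k) (hψ0 k) hs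
  -- The overflow of the truncation, already divided by the time. It is nonnegative, so summability
  -- of its means suffices.
  let ρ : ℕ → ℝ → ℝ := fun k y => ((y - μ) ^ 2 - min ((y - μ) ^ 2) ((k : ℝ) + 2)) / ((k : ℝ) + 2)
  have hρm : ∀ k, Measurable (ρ k) := fun k =>
    ((((measurable_id.sub_const μ).pow_const 2)).sub
      (((measurable_id.sub_const μ).pow_const 2).min measurable_const)).div_const _
  have hρ0 : ∀ k y, 0 ≤ ρ k y := fun k y =>
    div_nonneg (sub_nonneg.2 (min_le_left _ _)) (by positivity)
  have hrem : ∀ᵐ ω ∂P, Summable fun k => ρ k (Y (k + 1 + 1) ω) := by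
    refine ae_summable_of_summable_integral (fun k => ?_)
      (fun k => Eventually.of_forall fun ω => hρ0 k _) ?_
    · have hq := (h.memLp_size_sub (n := k + 1 + 1) (by omega)).integrable_sq
      exact (hq.sub (hq.inf (integrable_const _))).div_const _
    · refine (summable_inv_mul_sqrt.mul_left C).of_nonneg_of_le
        (fun k => integral_nonneg fun ω => hρ0 k _) fun k => ?_
      rw [h.integral_size_comp (by omega) (hρm k)]
      simp only [ρ]
      rw [integral_div]
      have hk : (0 : ℝ) < (k : ℝ) + 2 := by positivity
      have := hdiff (k + 1)
      rw [hk1] at this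
      refine (div_le_div_of_nonneg_right this hk.le).trans_eq ?_
      rw [div_div, mul_one_div, mul_comm (√_)]
  filter_upwards [hmart, hrem, h.ae_tendsto_axis_frequency hp i, h.ae_isAxisVector]
    with ω ⟨l, hl⟩ hr hfreq hω
  have hu : ∀ k, X (k + 1) ω i ^ 2 ≤ 1 := fun k => (hω _ (by omega)).sq_le_one i
  have hr' : Summable fun k => ρ k (Y (k + 1 + 1) ω) * X (k + 1 + 1) ω i ^ 2 :=
    hr.of_nonneg_of_le (fun k => mul_nonneg (hρ0 k _) (sq_nonneg _)) fun k =>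
      mul_le_of_le_one_right (hρ0 k _) (hu (k + 1))
  have hconv := hl.add hr'.hasSum.tendsto_sum_nat
  simp only [← Finset.sum_add_distrib] at hconv
  refine tendsto_log_average_mul (u := fun k => X (k + 1) ω i ^ 2)
    (w := fun k => (Y (k + 1) ω - μ) ^ 2) (c := c) (fun k => sq_nonneg _) hu hc
    (tendsto_sum_range_of_succ (hconv.congr fun n => Finset.sum_congr rfl fun k _ => ?_)) hfreq
  simp only [D, ρ, ψ]
  rw [hk1]
  have hk : (k : ℝ) + 2 ≠ 0 := by positivity
  field_simp
  ring

/-! ### Cross terms -/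

/-- The second moments of `Sₙ - μ Wₙ` grow at most linearly. -/
lemma memLp_centred_walk [IsProbabilityMeasure P] [NeZero d]
    (h : IsElephantWalk P d p μ η A β X Y) (i : Fin d) (n : ℕ) :
    MemLp (fun ω => ∑ k ∈ Finset.range n, (Y (k + 1) ω - μ) * X (k + 1) ω i) 2 P ∧
      ∫ ω, (∑ k ∈ Finset.range n, (Y (k + 1) ω - μ) * X (k + 1) ω i) ^ 2 ∂P
        ≤ (∫ ω, (Y 1 ω - μ) ^ 2 ∂P + η ^ 2) * n := by
  have hY1 : 0 ≤ ∫ ω, (Y 1 ω - μ) ^ 2 ∂P := integral_nonneg fun ω => sq_nonneg _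
  have hXm : ∀ k, Measurable fun ω => X (k + 1) ω i := fun k =>
    (measurable_pi_apply i).comp (h.measurable_X _ (by omega))
  have hle : ∀ k, ∀ᵐ ω ∂P, |(Y (k + 1) ω - μ) * X (k + 1) ω i| ≤ |Y (k + 1) ω - μ| := fun k => by
    filter_upwards [h.ae_isAxisVector] with ω hω
    rw [abs_mul]
    exact mul_le_of_le_one_right (abs_nonneg _) ((hω _ (by omega)).abs_le_one i)
  have hδ : ∀ k, MemLp (fun ω => (Y (k + 1) ω - μ) * X (k + 1) ω i) 2 P := fun k =>
    (h.memLp_size_sub (n := k + 1) (by omega)).mono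
      (((h.measurable_Y _ (by omega)).sub_const μ).mul (hXm k)).aestronglyMeasurable (hle k)
  have hδsq : ∀ k, ∫ ω, ((Y (k + 1) ω - μ) * X (k + 1) ω i) ^ 2 ∂P
      ≤ ∫ ω, (Y (k + 1) ω - μ) ^ 2 ∂P := fun k => by
    refine integral_mono_ae (hδ k).integrable_sq (h.memLp_size_sub (by omega)).integrable_sq ?_
    filter_upwards [hle k] with ω hω
    exact sq_le_sq.2 hω
  have hM : ∀ n, MemLp (fun ω => ∑ k ∈ Finset.range n, (Y (k + 1) ω - μ) * X (k + 1) ω i) 2 P :=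
    fun n => memLp_finsetSum _ fun k _ => hδ k
  refine ⟨hM n, ?_⟩
  induction n with
  | zero => simp
  | succ n ih =>
    -- `Y 1` need not have mean `μ`, so the first increment is bounded directly; this is why its
    -- second moment enters the constant. Orthogonality is available from the second increment on.
    rcases Nat.eq_zero_or_pos n with rfl | hn
    · have := hδsq 0
      simp only [zero_add, Finset.sum_range_one, Nat.cast_one, mul_one] at this ⊢
      nlinarith [sq_nonneg η]
    · have hf : Measurable[pastSigma X Y n]
          fun ω => ∑ k ∈ Finset.range n, (Y (k + 1) ω - μ) * X (k + 1) ω i := by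
        refine Finset.measurable_fun_sum _ fun k hk => ?_
        have hmem : k + 1 ∈ Finset.Icc 1 n :=
          Finset.mem_Icc.2 ⟨by omega, Finset.mem_range.1 hk⟩
        exact ((measurable_size_pastSigma hmem).sub_const μ).mul
          ((measurable_pi_apply i).comp (measurable_step_pastSigma hmem))
      have horth : ∫ ω, (∑ k ∈ Finset.range n, (Y (k + 1) ω - μ) * X (k + 1) ω i)
          * ((Y (n + 1) ω - μ) * X (n + 1) ω i) ∂P = 0 := by
        have := h.integral_step_size hn hf (measurable_pi_apply i) (ψ := fun y => y - μ)
          (measurable_id.sub_const μ)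
        rw [h.integral_size_sub (by omega), mul_zero] at this
        rw [← this]
        refine integral_congr_ae (Eventually.of_forall fun ω => ?_)
        ring
      have e : ∀ ω, (∑ k ∈ Finset.range (n + 1), (Y (k + 1) ω - μ) * X (k + 1) ω i) ^ 2
          = ((∑ k ∈ Finset.range n, (Y (k + 1) ω - μ) * X (k + 1) ω i) ^ 2
            + ((Y (n + 1) ω - μ) * X (n + 1) ω i) ^ 2)
            + 2 * ((∑ k ∈ Finset.range n, (Y (k + 1) ω - μ) * X (k + 1) ω i)
          * ((Y (n + 1) ω - μ) * X (n + 1) ω i)) := fun ω => by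
        rw [Finset.sum_range_succ]; ring
      simp only [e]
      rw [integral_add, integral_add, integral_const_mul, horth]
      · have h1 := hδsq n
        rw [h.integral_size_sub_sq (by omega)] at h1
        push_cast
        linarith
      · exact (hM n).integrable_sq
      · exact (hδ n).integrable_sq
      · exact (hM n).integrable_sq.add (hδ n).integrable_sq
      · exact ((hM n).integrable_mul (hδ n)).const_mul 2

/-- After division by (k+1)H_{k+1} the terms past the first are martingale increments of variance
O(1/(k H_k²)), by the linear growth of E M_k². Kronecker's lemma restores the factor H. -/
lemma ae_tendsto_cross_term [IsProbabilityMeasure P] [NeZero d]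
    (h : IsElephantWalk P d p μ η A β X Y) (i j : Fin d) :
    ∀ᵐ ω ∂P, Tendsto (fun n => (∑ k ∈ Finset.range n,
      (∑ l ∈ Finset.range k, (Y (l + 1) ω - μ) * X (l + 1) ω i)
        * ((Y (k + 1) ω - μ) * X (k + 1) ω j) / ((k : ℝ) + 1)) / harmonicSum n) atTop (𝓝 0) := by
  set K := ∫ ω, (Y 1 ω - μ) ^ 2 ∂P + η ^ 2 with hK
  have hK0 : 0 ≤ K := add_nonneg (integral_nonneg fun ω => sq_nonneg _) (sq_nonneg _)
  let f : ℕ → Ω → ℝ := fun k ω => (∑ l ∈ Finset.range (k + 1), (Y (l + 1) ω - μ) * X (l + 1) ω i)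
    / (((k : ℝ) + 2) * harmonicSum (k + 2))
  have hf : ∀ k, Measurable[pastSigma X Y (k + 1)] (f k) := fun k => by
    refine Measurable.div_const (Finset.measurable_fun_sum _ fun l hl => ?_) _
    have hmem : l + 1 ∈ Finset.Icc 1 (k + 1) :=
      Finset.mem_Icc.2 ⟨by omega, Finset.mem_range.1 hl⟩
    exact ((measurable_size_pastSigma hmem).sub_const μ).mul
      ((measurable_pi_apply i).comp (measurable_step_pastSigma hmem))
  have hf2 : ∀ k, MemLp (f k) 2 P := fun k => by
    simpa only [f, div_eq_mul_inv] using (h.memLp_centred_walk i (k + 1)).1.mul_const _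
  have hψ : Measurable fun y : ℝ => y - μ := measurable_id.sub_const μ
  let D : ℕ → Ω → ℝ := fun k ω => f k ω * X (k + 1 + 1) ω j * (Y (k + 1 + 1) ω - μ)
  have hD := fun k => h.memLp_step_size (n := k + 1) (by omega) (hf k) (hf2 k)
    (measurable_pi_apply j) (fun x hx => hx.abs_le_one j) hψ (h.memLp_size_sub (by omega))
  have hsum : Summable fun k => ∫ ω, D k ω ^ 2 ∂P := by
    refine (summable_inv_mul_harmonicSum_sq.mul_left (K * η ^ 2)).of_nonneg_of_le
      (fun k => integral_nonneg fun ω => sq_nonneg _) fun k => (hD k).2.trans ?_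
    rw [h.integral_size_sub_sq (by omega)]
    have hH : 0 < harmonicSum (k + 2) := zero_lt_one.trans_le (one_le_harmonicSum (k + 1))
    have hk : (0 : ℝ) < (k : ℝ) + 2 := by positivity
    simp only [f, div_pow]
    rw [integral_div]
    have hle : ∫ ω, (∑ l ∈ Finset.range (k + 1), (Y (l + 1) ω - μ) * X (l + 1) ω i) ^ 2 ∂P
        ≤ K * ((k : ℝ) + 2) := by
      refine (h.memLp_centred_walk i (k + 1)).2.trans ?_
      push_cast
      gcongr
      linarith
    calc _ ≤ K * ((k : ℝ) + 2) / (((k : ℝ) + 2) * harmonicSum (k + 2)) ^ 2 * η ^ 2 := by gcongr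
      _ = _ := by field_simp
  have hmart := ae_exists_tendsto_sum_of_orthogonal h.past (D := D) (fun k => ?_)
    (fun k => (hD k).1) (fun k s hs => ?_) hsum
  rotate_left
  · have hmem : k + 1 + 1 ∈ Finset.Icc 1 (k + 1 + 1) := Finset.mem_Icc.2 (by omega)
    exact (((hf k).mono (h.past.mono (Nat.le_succ k)) le_rfl).mul
      ((measurable_pi_apply j).comp (measurable_step_pastSigma hmem))).mul
      (hψ.comp (measurable_size_pastSigma hmem))
  · exact h.setIntegral_step_size (n := k + 1) (by omega) (hf k)
      (measurable_pi_apply j) hψ (h.integral_size_sub (by omega)) hs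
  filter_upwards [hmart] with ω ⟨l, hl⟩
  -- The full sequence, including index 0, whose empty inner sum makes it zero; the martingale
  -- increments are its shift by one.
  let x : ℕ → ℝ := fun k => (∑ l ∈ Finset.range k, (Y (l + 1) ω - μ) * X (l + 1) ω i)
    * ((Y (k + 1) ω - μ) * X (k + 1) ω j) / (((k : ℝ) + 1) * harmonicSum (k + 1))
  have hx := tendsto_sum_range_of_succ (f := x) (hl.congr fun n =>
    Finset.sum_congr rfl fun k _ => by
      simp only [D, f, x]
      push_cast
      ring)
  refine (tendsto_kronecker harmonicSum_zero monotone_harmonicSum tendsto_harmonicSum hx).congr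
    fun n => ?_
  congr 1
  refine Finset.sum_congr rfl fun k _ => ?_
  have hH : harmonicSum (k + 1) ≠ 0 := (zero_lt_one.trans_le (one_le_harmonicSum k)).ne'
  simp only [x]
  field_simp

lemma ae_walk_sub_eq (h : IsElephantWalk P d p μ η A β X Y) :
    ∀ᵐ ω ∂P, ∀ n i, (walkS A β X Y n ω - μ • walkW X n ω) i
      = ∑ k ∈ Finset.range n, (Y (k + 1) ω - μ) * X (k + 1) ω i := by
  have hr : ∀ᵐ ω ∂P, ∀ n, 1 ≤ n → X (n + 1) ω = A (n + 1) ω *ᵥ X (β n ω) ω :=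
    ae_all_iff.2 fun n => eventually_imp_distrib_left.2 fun hn => h.recursion n hn
  filter_upwards [hr] with ω hω n i
  have hstep : ∀ k, walkStep A β X Y (k + 1) ω = Y (k + 1) ω • X (k + 1) ω := fun k => by
    cases k with
    | zero => rfl
    | succ k => rw [hω (k + 1) (by omega)]; rfl
  simp only [walkS, walkW, sum_Icc_one_eq_sum_range, hstep, Pi.sub_apply, Pi.smul_apply,
    Finset.sum_apply, smul_eq_mul, Finset.mul_sum, ← Finset.sum_sub_distrib, sub_mul]

end IsElephantWalk

/-! ### Assembly, entry by entry -/

theorem mainTheorem7 {Ω : Type*} [MeasurableSpace Ω] (P : Measure Ω) [IsProbabilityMeasure P]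
    (d : ℕ) (hd : 1 ≤ d) (p μ η : ℝ) (hp0 : 0 ≤ p) (hp1 : p ≤ 1)
    (hp : 2 ≤ d → p < 1)
    (A : ℕ → Ω → Matrix (Fin d) (Fin d) ℝ) (β : ℕ → Ω → ℕ)
    (X : ℕ → Ω → Fin d → ℝ) (Y : ℕ → Ω → ℝ)
    (hwalk : IsElephantWalk P d p μ η A β X Y)
    (hthird : ∀ n, 1 ≤ n → Integrable (fun ω => |Y n ω - μ| ^ 3) P) :
    ∀ᵐ ω ∂P, Tendsto
      (fun n : ℕ => (1 / Real.log ((n : ℝ) + 1)) •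
        ∑ k ∈ Finset.Icc 1 n, (1 / ((k : ℝ) * ((k : ℝ) + 1))) •
          Matrix.vecMulVec (walkS A β X Y k ω - μ • walkW X k ω)
            (walkS A β X Y k ω - μ • walkW X k ω))
      atTop (𝓝 ((η ^ 2 / (d : ℝ)) • (1 : Matrix (Fin d) (Fin d) ℝ))) := by
  have : NeZero d := ⟨by omega⟩
  have hdiag : ∀ᵐ ω ∂P, ∀ i, Tendsto (fun n => (∑ k ∈ Finset.range n,
      (Y (k + 1) ω - μ) ^ 2 * X (k + 1) ω i ^ 2 / ((k : ℝ) + 1)) / harmonicSum n) atTop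
      (𝓝 (η ^ 2 * (1 / d))) :=
    ae_all_iff.2 fun i => hwalk.ae_tendsto_weighted_axis_frequency hp (hthird 2 (by omega)) i
  have hcross : ∀ᵐ ω ∂P, ∀ i j, Tendsto (fun n => (∑ k ∈ Finset.range n,
      (∑ l ∈ Finset.range k, (Y (l + 1) ω - μ) * X (l + 1) ω i)
        * ((Y (k + 1) ω - μ) * X (k + 1) ω j) / ((k : ℝ) + 1)) / harmonicSum n) atTop (𝓝 0) :=
    ae_all_iff.2 fun i => ae_all_iff.2 fun j => hwalk.ae_tendsto_cross_term i j
  filter_upwards [hdiag, hcross, hwalk.ae_isAxisVector, hwalk.ae_walk_sub_eq] with ω h1 h2 h3 h4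
  refine tendsto_pi_nhds.2 fun i => tendsto_pi_nhds.2 fun j => ?_
  have hquad : Tendsto (fun n => (∑ k ∈ Finset.range n, ((Y (k + 1) ω - μ) * X (k + 1) ω i)
      * ((Y (k + 1) ω - μ) * X (k + 1) ω j) / ((k : ℝ) + 1)) / harmonicSum n) atTop
      (𝓝 (((η ^ 2 / (d : ℝ)) • (1 : Matrix (Fin d) (Fin d) ℝ)) i j)) := by
    by_cases hij : i = j
    · subst hij
      rw [Matrix.smul_apply, Matrix.one_apply_eq, smul_eq_mul, mul_one, ← mul_one_div]
      refine (h1 i).congr fun n => ?_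
      congr 1
      exact Finset.sum_congr rfl fun k _ => by ring
    · rw [Matrix.smul_apply, Matrix.one_apply_ne hij, smul_zero]
      refine tendsto_const_nhds.congr fun n => ?_
      rw [Finset.sum_eq_zero, zero_div]
      intro k _
      -- Off the diagonal each term vanishes, a direction having at most one nonzero coordinate.
      rw [mul_mul_mul_comm, (h3 (k + 1) (by omega)).2 i j hij, mul_zero, zero_div]
  refine (tendsto_quadratic_strong_law hquad (h2 i j) (h2 j i)).congr fun n => ?_
  rw [Matrix.smul_apply, Matrix.sum_apply, sum_Icc_one_eq_sum_range, smul_eq_mul, div_eq_mul_one_div,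
    mul_comm]
  congr 1
  refine Finset.sum_congr rfl fun k _ => ?_
  rw [Matrix.smul_apply, Matrix.vecMulVec_apply, h4, h4, smul_eq_mul]
  push_cast
  ring
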